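/- **Theorem 3 (Representation "B").** For real $\rho>1/2$ and complex $\mu,z$ let $$E_{\rho,\mu}(z)=\sum_{k=0}^\infty \frac{z^k}{\Gamma(\mu+k/\rho)}$$ (a series that converges for every $z\in\mathbb C$; $1/\Gamma$ is $0$ at the poles of $\Gamma$). Let $\arg z\in[0,2\pi)$ denote the argument with the cut along the positive real axis; for $r>0$ and $a\in\mathbb C$ put $(zr)^a=\exp\{a(\ln(|z|r)+i\arg z)\}$ and $(zre^{-i\pi})^a=(zr)^ae^{-i\pi a}$. Define $$\eta(r,\varphi,z)=(zr)^\rho e^{-i\rho\pi}\sin(\rho\varphi)+\rho(1-\mu)\varphi,$$ $$A_{\rho,\mu}(r,\omega_1,\omega_2,z)=\exp\{(zr)^\rho e^{-i\rho\pi}\cos(\rho\omega_1)\}(r^2+2r\cos\omega_2+1)e^{i\eta(r,\omega_1,z)}(r+e^{i\omega_1}),$$ $$K_{\rho,\mu}(r,\varphi_1,\varphi_2,z)=\frac{\rho}{2\pi i}\,\frac{(zr)^{\rho(1-\mu)}e^{-i\rho\pi(1-\mu)}\,[A_{\rho,\mu}(r,\varphi_2,\varphi_1,z)-A_{\rho,\mu}(r,\varphi_1,\varphi_2,z)]}{(r^2+2r\cos\varphi_1+1)(r^2+2r\cos\varphi_2+1)},$$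 $$K_{\rho,\mu}(r,\varphi,z)=\frac{\rho}{\pi}(zre^{-i\pi})^{\rho(1-\mu)}\exp\{(zre^{-i\pi})^\rho\cos(\rho\varphi)\}\frac{r\sin(\eta(r,\varphi,z))+\sin(\eta(r,\varphi,z)+\varphi)}{r^2+2r\cos\varphi+1},$$ $$K'_{\rho,\mu}(r,\varphi,z)=\frac{\rho}{2\pi i}\,\frac{\exp\{(zr)^\rho e^{-i\pi\rho}\cos(\rho\varphi)\}}{r^2+2r\cos\varphi+1}(zr)^{\rho(1-\mu)}e^{i[\eta(r,\varphi,z)-\pi\rho(1-\mu)]}(r+e^{i\varphi}),$$ and, with $r(\tau,\psi)=\sqrt{\tau^2+2\tau\cos\psi+1}$, $\varphi(\tau,\psi,k)=\arctan\left(\frac{\tau\sin\psi}{\tau\cos\psi+1}\right)+k\pi$ and $\chi'(\tau,\psi,k,z)=(zr(\tau,\psi))^\rho\sin(\rho\varphi(\tau,\psi,k))+\rho(1-\mu)\varphi(\tau,\psi,k)$, $$P'_{\rho,\mu}(\tau,\psi,k,z)=\frac{\rho\tau}{2\pi}\,\frac{\exp\{(zr(\tau,\psi))^\rho\cos(\rho\varphi(\tau,\psi,k))\}}{r(\tau,\psi)^2-2r(\tau,\psi)\cos\varphi(\tau,\psi,k)+1}(zr(\tau,\psi))^{\rho(1-\mu)}e^{i[\chi'(\tau,\psi,k,z)+\psi]}\left(r(\tau,\psi)e^{-i\varphi(\tau,\psi,k)}-1\right).$$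 Let $\rho>1/2$ be real and $\mu\in\mathbb C$ with $\Re\mu<1+1/\rho$. Then the following representations hold, all the integrals in them being absolutely convergent. 1. Let $\delta_1,\delta_2$ be real with $\frac{\pi}{2\rho}<\delta_1,\delta_2\le\frac{\pi}{\rho}$ if $\rho>1$, and $\frac{\pi}{2\rho}<\delta_1,\delta_2<\pi$ if $1/2<\rho\le1$. For every $z\in\mathbb C$ with $\frac{\pi}{2\rho}-\delta_2+\pi<\arg z<-\frac{\pi}{2\rho}+\delta_1+\pi$, $$E_{\rho,\mu}(z)=\int_0^\infty K_{\rho,\mu}(r,-\delta_1,\delta_2,z)\,dr.$$ 2. Let $1/2<\rho\le1$ and $\frac{\pi}{2\rho}<\delta_2<\pi$. For every $z$ with $\frac{\pi}{2\rho}-\delta_2+\pi<\arg z<-\frac{\pi}{2\rho}+2\pi$ and every $0<\varepsilon_1<1$, $$E_{\rho,\mu}(z)=\int_0^\infty K'_{\rho,\mu}(r,\delta_2,z)\,dr-\int_0^{1-\varepsilon_1}K'_{\rho,\mu}(r,-\pi,z)\,dr-\int_{1+\varepsilon_1}^\infty K'_{\rho,\mu}(r,-\pi,z)\,dr+\int_{-2\pi}^{-\pi}P'_{\rho,\mu}(\varepsilon_1,\psi,-2,z)\,d\psi.$$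 3. Let $1/2<\rho\le1$ and $\frac{\pi}{2\rho}<\delta_1<\pi$. For every $z$ with $\frac{\pi}{2\rho}<\arg z<-\frac{\pi}{2\rho}+\delta_1+\pi$ and every $0<\varepsilon_1<1$, $$E_{\rho,\mu}(z)=\int_0^{1-\varepsilon_1}K'_{\rho,\mu}(r,\pi,z)\,dr+\int_{1+\varepsilon_1}^\infty K'_{\rho,\mu}(r,\pi,z)\,dr+\int_{-\pi}^{0}P'_{\rho,\mu}(\varepsilon_1,\psi,0,z)\,d\psi-\int_0^\infty K'_{\rho,\mu}(r,-\delta_1,z)\,dr.$$ 4. Let $1/2<\rho\le1$. For every $z$ with $\frac{\pi}{2\rho}<\arg z<-\frac{\pi}{2\rho}+2\pi$ and every $0<\varepsilon_1<1$, $$E_{\rho,\mu}(z)=\int_0^{1-\varepsilon_1}K_{\rho,\mu}(r,\pi,z)\,dr+\int_{1+\varepsilon_1}^\infty K_{\rho,\mu}(r,\pi,z)\,dr+\int_{-\pi}^{0}P'_{\rho,\mu}(\varepsilon_1,\psi,0,z)\,d\psi+\int_{-2\pi}^{-\pi}P'_{\rho,\mu}(\varepsilon_1,\psi,-2,z)\,d\psi.$$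 -/

import Mathlib

open MeasureTheory
open scoped Real

noncomputable section

/-- The `k`-th term `z ^ k / Γ(μ + k / ρ)` of the Mittag-Leffler series. Mathlib's `Complex.Gamma`
is `0` at its poles, so the quotient is `0` there, as it should be (`1 / Γ` vanishes at the poles). -/
def mlTerm (ρ : ℝ) (μ z : ℂ) (k : ℕ) : ℂ :=
  z ^ k / Complex.Gamma (μ + (k : ℂ) / (ρ : ℂ))

/-- The two-parameter Mittag-Leffler function `E_{ρ,μ}(z) = ∑ z ^ k / Γ(μ + k / ρ)`. -/
def mlE (ρ : ℝ) (μ z : ℂ) : ℂ := ∑' k : ℕ, mlTerm ρ μ z k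

/-- The argument with the cut along the positive real axis: its values lie in `[0, 2π)`
(with the value `0` at `z = 0`). -/
def mlArg (z : ℂ) : ℝ := if 0 ≤ Complex.arg z then Complex.arg z else Complex.arg z + 2 * π

/-- The power `w ^ a = exp (a (log |w| + i arg w))`, `w ≠ 0`, for the argument `mlArg`. -/
def mlPow (w a : ℂ) : ℂ :=
  Complex.exp (a * ((Real.log ‖w‖ : ℂ) + (mlArg w : ℂ) * Complex.I))

/-- `η(r, φ, z) = (z r)^ρ e^{-iρπ} sin (ρ φ) + ρ (1 - μ) φ`. -/
def mlEta (ρ : ℝ) (μ : ℂ) (r φ : ℝ) (z : ℂ) : ℂ :=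
  mlPow (z * r) ρ * Complex.exp (-Complex.I * ρ * π) * (Real.sin (ρ * φ) : ℂ) + ρ * (1 - μ) * φ

/-- `A(r, ω₁, ω₂, z)`, the auxiliary function in the kernel `mlK`. -/
def mlA (ρ : ℝ) (μ : ℂ) (r ω₁ ω₂ : ℝ) (z : ℂ) : ℂ :=
  Complex.exp (mlPow (z * r) ρ * Complex.exp (-Complex.I * ρ * π) * (Real.cos (ρ * ω₁) : ℂ)) *
    ((r ^ 2 + 2 * r * Real.cos ω₂ + 1 : ℝ) : ℂ) *
    Complex.exp (Complex.I * mlEta ρ μ r ω₁ z) * (r + Complex.exp (Complex.I * ω₁))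

/-- The kernel `K(r, φ₁, φ₂, z)`. -/
def mlK (ρ : ℝ) (μ : ℂ) (r φ₁ φ₂ : ℝ) (z : ℂ) : ℂ :=
  ρ / (2 * π * Complex.I) *
    (mlPow (z * r) (ρ * (1 - μ)) * Complex.exp (-Complex.I * ρ * π * (1 - μ)) *
        (mlA ρ μ r φ₂ φ₁ z - mlA ρ μ r φ₁ φ₂ z) /
      (((r ^ 2 + 2 * r * Real.cos φ₁ + 1) * (r ^ 2 + 2 * r * Real.cos φ₂ + 1) : ℝ) : ℂ))

/-- The kernel `K(r, φ, z)` with a single angle; the power `(z r e^{-iπ})^a` is taken with the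
argument `arg z - π`, that is, it is `(z r)^a e^{-iπa}`. -/
def mlKSym (ρ : ℝ) (μ : ℂ) (r φ : ℝ) (z : ℂ) : ℂ :=
  ρ / π * (mlPow (z * r) (ρ * (1 - μ)) * Complex.exp (-Complex.I * π * (ρ * (1 - μ)))) *
    Complex.exp
      (mlPow (z * r) ρ * Complex.exp (-Complex.I * π * ρ) * (Real.cos (ρ * φ) : ℂ)) *
    ((r * Complex.sin (mlEta ρ μ r φ z) + Complex.sin (mlEta ρ μ r φ z + φ)) /
      ((r ^ 2 + 2 * r * Real.cos φ + 1 : ℝ) : ℂ))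

/-- The one-ray kernel `K'(r, φ, z)`. -/
def mlK' (ρ : ℝ) (μ : ℂ) (r φ : ℝ) (z : ℂ) : ℂ :=
  ρ / (2 * π * Complex.I) *
    (Complex.exp
        (mlPow (z * r) ρ * Complex.exp (-Complex.I * π * ρ) * (Real.cos (ρ * φ) : ℂ)) /
      ((r ^ 2 + 2 * r * Real.cos φ + 1 : ℝ) : ℂ)) *
    mlPow (z * r) (ρ * (1 - μ)) *
    Complex.exp (Complex.I * (mlEta ρ μ r φ z - π * ρ * (1 - μ))) *
    (r + Complex.exp (Complex.I * φ))

/-- `r(τ, ψ) = √(τ² + 2 τ cos ψ + 1)`. -/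
def mlRad (τ ψ : ℝ) : ℝ := Real.sqrt (τ ^ 2 + 2 * τ * Real.cos ψ + 1)

/-- `φ(τ, ψ, k) = arctan (τ sin ψ / (τ cos ψ + 1)) + k π`. -/
def mlAng (τ ψ : ℝ) (k : ℤ) : ℝ :=
  Real.arctan (τ * Real.sin ψ / (τ * Real.cos ψ + 1)) + k * π

/-- `χ'(τ, ψ, k, z) = (z r(τ,ψ))^ρ sin (ρ φ(τ,ψ,k)) + ρ (1 - μ) φ(τ,ψ,k)`. -/
def mlChi' (ρ : ℝ) (μ : ℂ) (τ ψ : ℝ) (k : ℤ) (z : ℂ) : ℂ :=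
  mlPow (z * mlRad τ ψ) ρ * (Real.sin (ρ * mlAng τ ψ k) : ℂ) + ρ * (1 - μ) * mlAng τ ψ k

/-- The integrand `P'(τ, ψ, k, z)` on a small arc of radius `τ` around the pole. -/
def mlP' (ρ : ℝ) (μ : ℂ) (τ ψ : ℝ) (k : ℤ) (z : ℂ) : ℂ :=
  ρ * τ / (2 * π) *
    (Complex.exp (mlPow (z * mlRad τ ψ) ρ * (Real.cos (ρ * mlAng τ ψ k) : ℂ)) /
      ((mlRad τ ψ ^ 2 - 2 * mlRad τ ψ * Real.cos (mlAng τ ψ k) + 1 : ℝ) : ℂ)) *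
    mlPow (z * mlRad τ ψ) (ρ * (1 - μ)) *
    Complex.exp (Complex.I * (mlChi' ρ μ τ ψ k z + ψ)) *
    (mlRad τ ψ * Complex.exp (-Complex.I * mlAng τ ψ k) - 1)

end

/-! Hankel's formula for `1 / Γ`, applied to each term of the series, gives `E(z) = ρ/(2πi) ∫
exp(w^ρ) w^{ρ(1-μ)} / (w - z) dw` along a contour whose two ends go to infinity in the sectors `π/2
< |ρ arg w| < 3π/2`, where `exp(w^ρ)` decays. For `ρ < 1` the angle `π/ρ` exceeds `π`, so the
contour lives on the Riemann surface of the logarithm. The work is therefore done in the coordinate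
`s = log w`, where all powers are entire and the only poles are the logarithms of `z`.

`tendsto_hankelArc` states Hankel's formula as a limit of integrals over full circles. Expanding `w
/ (w - z)` geometrically on arcs `|arg w| ≤ π/ρ` of radius `b > ‖z‖`, with a majorant that does not
depend on `b`, shows that the arc integrals tend to `2π/ρ · E(z)`. The ends of the arcs may then
slide inside the sectors of decay (`tendsto_integral_mlIntegrand`).

Put `w = -z r e^{iφ}`. Then `K' dr` is the contour form on the ray of angle `φ` (`mlK'_eq`), the two
other ray kernels are differences of two values of `K'` (`mlK_eq`, `mlKSym_eq`), and `P' dψ` is the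
same form on a small circle around a pole (`mlP'_eq`). With `v = s - log z`, the form is holomorphic
on a star-shaped region that crosses the imaginary axis only between the consecutive poles `-2πi`
and `0`, so it has a primitive there. Its values at the four corners of the sector cut out by two
rays and the radii `‖z‖/b` and `‖z‖b` compare the ray integrals with the arc integrals. As `b → ∞`
the outer arc gives `E(z)`, and the inner one vanishes because `Re μ < 1 + 1/ρ` (`mlE_eq_sub`).

A ray with `φ = ±π` meets a pole. Near the pole it is replaced by a half circle on the side of the
other ray, which accounts for the integrals of `P'`. -/

/-! ### Primitives and integrals along paths. -/

/-- A holomorphic function on a star-shaped open set has a primitive. -/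
theorem StarConvex.exists_primitive {U : Set ℂ} {c : ℂ} (hU : IsOpen U) (hs : StarConvex ℝ c U)
    {f : ℂ → ℂ} (hf : DifferentiableOn ℂ f U) :
    ∃ F : ℂ → ℂ, ∀ z ∈ U, HasDerivAt F (f z) z := by
  have hf' : ContinuousOn (deriv f) U := (hf.deriv hU).continuousOn
  have hmem : ∀ z ∈ U, ∀ t ∈ Set.Icc (0 : ℝ) 1, c + t * (z - c) ∈ U := by
    intro z hz t ht
    have := hs hz (sub_nonneg.2 ht.2) ht.1 (by ring)
    convert this using 1
    simp only [Complex.real_smul]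
    push_cast
    ring
  -- The primitive is the integral along the segment from the centre. Its derivative is computed
  -- under the integral sign, and the resulting integrand is the `t`-derivative of `t * f (c + t *
  -- (z - c))`.
  refine ⟨fun z => ∫ t in (0 : ℝ)..1, f (c + t * (z - c)) * (z - c), fun z hz => ?_⟩
  obtain ⟨δ, hδ, hball⟩ := Metric.nhds_basis_closedBall.mem_iff.1 (hU.mem_nhds hz)
  have hcont : ContinuousOn (fun p : ℂ × ℝ => c + (p.2 : ℂ) * (p.1 - c))
      (Metric.closedBall z δ ×ˢ Set.Icc (0 : ℝ) 1) := by fun_prop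
  have hmaps : Set.MapsTo (fun p : ℂ × ℝ => c + (p.2 : ℂ) * (p.1 - c))
      (Metric.closedBall z δ ×ˢ Set.Icc (0 : ℝ) 1) U :=
    fun p hp => hmem p.1 (hball hp.1) p.2 hp.2
  have hF' : ContinuousOn (fun p : ℂ × ℝ => deriv f (c + p.2 * (p.1 - c)) * p.2 * (p.1 - c) +
      f (c + p.2 * (p.1 - c))) (Metric.closedBall z δ ×ˢ Set.Icc (0 : ℝ) 1) := by
    refine ContinuousOn.add (ContinuousOn.mul (ContinuousOn.mul (hf'.comp hcont hmaps) ?_) ?_)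
      (hf.continuousOn.comp hcont hmaps) <;> fun_prop
  have hF : ContinuousOn (fun p : ℂ × ℝ => f (c + p.2 * (p.1 - c)) * (p.1 - c))
      (Metric.closedBall z δ ×ˢ Set.Icc (0 : ℝ) 1) := by
    refine ContinuousOn.mul (hf.continuousOn.comp hcont hmaps) ?_
    fun_prop
  obtain ⟨B, hB⟩ := ((isCompact_closedBall z δ).prod isCompact_Icc).exists_bound_of_continuousOn hF'
  have hFx : ∀ x ∈ Metric.closedBall z δ,
      ContinuousOn (fun t : ℝ => f (c + t * (x - c)) * (x - c)) (Set.Icc 0 1) := fun x hx =>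
    hF.comp (f := fun t : ℝ => (x, t)) (by fun_prop) fun t ht => ⟨hx, ht⟩
  have hFx' : ∀ x ∈ Metric.closedBall z δ, ContinuousOn (fun t : ℝ =>
      deriv f (c + t * (x - c)) * t * (x - c) + f (c + t * (x - c))) (Set.Icc 0 1) := fun x hx =>
    hF'.comp (f := fun t : ℝ => (x, t)) (by fun_prop) fun t ht => ⟨hx, ht⟩
  have hI : Set.uIoc (0 : ℝ) 1 ⊆ Set.Icc 0 1 := by
    rw [Set.uIoc_of_le zero_le_one]; exact Set.Ioc_subset_Icc_self
  have hzb : z ∈ Metric.closedBall z δ := Metric.mem_closedBall_self hδ.le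
  have key := intervalIntegral.hasDerivAt_integral_of_dominated_loc_of_deriv_le
    (𝕜 := ℂ) (μ := volume) (a := 0) (b := 1) (bound := fun _ => B)
    (F := fun x t => f (c + (t : ℂ) * (x - c)) * (x - c))
    (F' := fun x t => deriv f (c + (t : ℂ) * (x - c)) * t * (x - c) + f (c + (t : ℂ) * (x - c)))
    (x₀ := z) (Metric.closedBall_mem_nhds z hδ) ?_ ?_ ?_ ?_ ?_ ?_
  · have h2 := key.2
    refine h2.congr_deriv ?_
    have : ∀ t ∈ Set.uIcc (0 : ℝ) 1, HasDerivAt (fun t : ℝ => (t : ℂ) * f (c + t * (z - c)))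
        (deriv f (c + t * (z - c)) * t * (z - c) + f (c + t * (z - c))) t := by
      intro t ht
      rw [Set.uIcc_of_le zero_le_one] at ht
      have h0 : HasDerivAt (fun t : ℝ => (t : ℂ)) 1 t := Complex.ofRealCLM.hasDerivAt
      have h1 : HasDerivAt (fun t : ℝ => c + (t : ℂ) * (z - c)) (z - c) t := by
        simpa using (h0.mul_const (z - c)).const_add c
      have h3 := (hf.differentiableAt (hU.mem_nhds (hmem z hz t ht))).hasDerivAt
      have h4 := h0.mul (HasDerivAt.comp t h3 h1)
      refine h4.congr_deriv ?_
      simp only [Function.comp]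
      ring
    rw [intervalIntegral.integral_eq_sub_of_hasDerivAt this]
    · simp
    · exact ((hFx' z hzb).mono (by rw [Set.uIcc_of_le zero_le_one])).intervalIntegrable
  · filter_upwards [Metric.closedBall_mem_nhds z hδ] with x hx
    exact ((hFx x hx).mono hI).aestronglyMeasurable measurableSet_uIoc
  · exact ((hFx z hzb).mono (by rw [Set.uIcc_of_le zero_le_one])).intervalIntegrable
  · exact ((hFx' z hzb).mono hI).aestronglyMeasurable measurableSet_uIoc
  · exact Filter.Eventually.of_forall fun t ht x hx => hB (x, t) ⟨hx, hI ht⟩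
  · exact intervalIntegrable_const
  · refine Filter.Eventually.of_forall fun t ht x hx => ?_
    have h1 : HasDerivAt (fun x : ℂ => c + (t : ℂ) * (x - c)) t x := by
      simpa using (((hasDerivAt_id x).sub_const c).const_mul (t : ℂ)).const_add c
    have h3 := (hf.differentiableAt (hU.mem_nhds (hmem x (hball hx) t (hI ht)))).hasDerivAt
    have h4 := (HasDerivAt.comp x h3 h1).mul ((hasDerivAt_id x).sub_const c)
    refine h4.congr_deriv ?_
    simp [Function.comp]

/-- The fundamental theorem of calculus along a path. -/
theorem integral_comp_mul_deriv_of_primitive {F f : ℂ → ℂ} {γ γ' : ℝ → ℂ} {a b : ℝ}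
    (hγ : ∀ t ∈ Set.uIcc a b, HasDerivAt γ (γ' t) t)
    (hF : ∀ t ∈ Set.uIcc a b, HasDerivAt F (f (γ t)) (γ t))
    (hi : IntervalIntegrable (fun t => f (γ t) * γ' t) volume a b) :
    ∫ t in a..b, f (γ t) * γ' t = F (γ b) - F (γ a) :=
  intervalIntegral.integral_eq_sub_of_hasDerivAt
    (fun t ht => HasDerivAt.comp t (hF t ht) (hγ t ht)) hi

theorem hasDerivAt_vertical (X θ : ℝ) :
    HasDerivAt (fun t : ℝ => (X : ℂ) + t * Complex.I) Complex.I θ := by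
  have h0 : HasDerivAt (fun t : ℝ => (t : ℂ)) 1 θ := Complex.ofRealCLM.hasDerivAt
  simpa using (h0.mul_const Complex.I).const_add (X : ℂ)

theorem hasDerivAt_log_add (c : ℂ) {r : ℝ} (hr : 0 < r) :
    HasDerivAt (fun t : ℝ => c + (Real.log t : ℂ)) (r : ℂ)⁻¹ r := by
  have := (Real.hasDerivAt_log hr.ne').ofReal_comp.const_add c
  simpa using this

/-! ### Hankel's formula for the reciprocal Gamma function. -/

/-- The integrand of Hankel's integral for `1 / Γ(ν)` in the logarithmic coordinate. -/
noncomputable def hankelKernel (ν s : ℂ) : ℂ :=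
  Complex.exp (Complex.exp s) * Complex.exp ((1 - ν) * s)

/-- The integral of the Hankel kernel over a full circle of radius `b`. -/
noncomputable def hankelArc (ν : ℂ) (b : ℝ) : ℂ :=
  ∫ θ in (-π)..π, hankelKernel ν ((Real.log b : ℂ) + θ * Complex.I)

theorem differentiable_hankelKernel (ν : ℂ) : Differentiable ℂ (hankelKernel ν) := by
  unfold hankelKernel; fun_prop

theorem exp_log_add_mul_I {r : ℝ} (hr : 0 < r) (θ : ℝ) :
    Complex.exp ((Real.log r : ℂ) + θ * Complex.I) = r * Complex.exp (θ * Complex.I) := by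
  rw [Complex.exp_add, ← Complex.ofReal_exp, Real.exp_log hr]

theorem norm_hankelKernel_le (ν : ℂ) {b θ : ℝ} (hb : 0 < b) (hθ : |θ| ≤ π) :
    ‖hankelKernel ν ((Real.log b : ℂ) + θ * Complex.I)‖ ≤
      Real.exp b * b ^ (1 - ν.re) * Real.exp (π * |ν.im|) := by
  rw [hankelKernel, norm_mul, Complex.norm_exp, Complex.norm_exp, exp_log_add_mul_I hb, mul_assoc]
  gcongr
  · rw [Complex.re_ofReal_mul, Complex.exp_ofReal_mul_I_re]
    nlinarith [Real.cos_le_one θ]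
  · rw [Real.rpow_def_of_pos hb, ← Real.exp_add]
    gcongr
    have : θ * ν.im ≤ π * |ν.im| := by
      calc θ * ν.im ≤ |θ * ν.im| := le_abs_self _
        _ = |θ| * |ν.im| := abs_mul _ _
        _ ≤ _ := by gcongr
    simp
    linarith

theorem norm_hankelArc_le (ν : ℂ) {b : ℝ} (hb : 0 < b) :
    ‖hankelArc ν b‖ ≤ Real.exp b * b ^ (1 - ν.re) * Real.exp (π * |ν.im|) * (2 * π) := by
  have h := intervalIntegral.norm_integral_le_of_norm_le_const (a := -π) (b := π)
    (f := fun θ : ℝ => hankelKernel ν ((Real.log b : ℂ) + θ * Complex.I))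
    (C := Real.exp b * b ^ (1 - ν.re) * Real.exp (π * |ν.im|)) ?_
  · refine h.trans_eq ?_
    rw [sub_neg_eq_add, ← two_mul, abs_of_pos Real.two_pi_pos]
  · intro θ hθ
    rw [Set.uIoc_of_le (by linarith [Real.pi_pos])] at hθ
    exact norm_hankelKernel_le ν hb (abs_le.2 ⟨hθ.1.le, hθ.2⟩)

/-- Cauchy's theorem for the Hankel kernel, between two circles cut along the negative axis. -/
theorem hankelArc_sub (ν : ℂ) {a b : ℝ} (ha : 0 < a) (hab : a ≤ b) :
    Complex.I * (hankelArc ν b - hankelArc ν a) =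
      (Complex.exp (π * Complex.I * (1 - ν)) - Complex.exp (-(π * Complex.I * (1 - ν)))) *
        ∫ r in a..b, (Real.exp (-r) : ℂ) * (r : ℂ) ^ (-ν) := by
  obtain ⟨F, hF⟩ := StarConvex.exists_primitive (c := 0) isOpen_univ (starConvex_univ 0)
    (differentiable_hankelKernel ν).differentiableOn
  have hc := (differentiable_hankelKernel ν).continuous
  have hvert : ∀ R : ℝ, hankelArc ν R * Complex.I =
      F ((Real.log R : ℂ) + π * Complex.I) - F ((Real.log R : ℂ) + (-π : ℝ) * Complex.I) := by
    intro R
    rw [hankelArc, ← intervalIntegral.integral_mul_const]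
    refine integral_comp_mul_deriv_of_primitive (F := F) (fun t _ => hasDerivAt_vertical _ t)
      (fun t _ => hF _ trivial) ?_
    exact Continuous.intervalIntegrable (by fun_prop) _ _
  have hpos : ∀ r ∈ Set.uIcc a b, 0 < r := by
    intro r hr
    rw [Set.uIcc_of_le hab] at hr
    linarith [hr.1]
  -- Both edges of the cut have the form `c + log r` with `exp c = -1`, for `c = ±πi`; they carry
  -- the same real integral and differ only in the factor `exp (c * (1 - ν))`.
  have hray : ∀ c : ℂ, Complex.exp c = -1 → F (c + Real.log b) - F (c + Real.log a) =
      Complex.exp (c * (1 - ν)) * ∫ r in a..b, (Real.exp (-r) : ℂ) * (r : ℂ) ^ (-ν) := by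
    intro c hc1
    rw [← intervalIntegral.integral_const_mul]
    rw [← integral_comp_mul_deriv_of_primitive (f := hankelKernel ν) (γ := fun r : ℝ => c + Real.log r)
      (fun r hr => hasDerivAt_log_add c (hpos r hr)) (fun r _ => hF _ trivial)]
    · refine intervalIntegral.integral_congr fun r hr => ?_
      have hr0 := hpos r hr
      have hr1 : (r : ℂ) ≠ 0 := by exact_mod_cast hr0.ne'
      have hl : Complex.exp (Real.log r : ℂ) = r := by
        rw [← Complex.ofReal_exp, Real.exp_log hr0]
      have h2 : (r : ℂ)⁻¹ = Complex.exp (-(Real.log r : ℂ)) := by rw [Complex.exp_neg, hl]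
      simp only [hankelKernel]
      rw [Complex.exp_add c, hc1, hl, Complex.cpow_def_of_ne_zero hr1, ← Complex.ofReal_log hr0.le, h2,
        mul_assoc, ← Complex.exp_add, mul_left_comm, ← Complex.exp_add, Complex.ofReal_exp]
      simp only [← Complex.exp_add]
      congr 1
      push_cast
      ring
    · refine ContinuousOn.intervalIntegrable ?_
      refine ContinuousOn.mul (hc.comp_continuousOn ?_) ?_
      · refine continuousOn_const.add (Complex.continuous_ofReal.comp_continuousOn ?_)
        exact Real.continuousOn_log.mono fun r hr => (hpos r hr).ne'
      · refine ContinuousOn.inv₀ (by fun_prop) fun r hr => ?_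
        exact_mod_cast (hpos r hr).ne'
  have h1 := hray (π * Complex.I) Complex.exp_pi_mul_I
  have h2 := hray ((-π : ℝ) * Complex.I) (by
    rw [Complex.ofReal_neg, neg_mul, Complex.exp_neg, Complex.exp_pi_mul_I]; norm_num)
  have h3 := hvert a
  have h4 := hvert b
  rw [add_comm] at h1 h2
  rw [add_comm _ (Real.log a : ℂ)] at h1 h2
  have e : (((-π : ℝ) : ℂ) * Complex.I * (1 - ν)) = -(π * Complex.I * (1 - ν)) := by
    push_cast; ring
  rw [e] at h2
  linear_combination h4 - h3 + h1 - h2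

/-- The constant is uniform in both `κ` and `b`, which later makes limit and sum interchangeable.
The arcs of radii `a` and `b` differ by integrals over the cut, where `r ^ (-κ) ≤ a ^ (-κ)`; the
imaginary part of the parameter, hence the size of the exponential factors, does not change with
`κ`. -/
theorem exists_norm_hankelArc_le (μ : ℂ) {a : ℝ} (ha : 0 < a) :
    ∃ C : ℝ, ∀ κ : ℝ, 0 ≤ κ → ∀ b, a ≤ b → ‖hankelArc (μ + κ) b‖ ≤ C * a ^ (-κ) := by
  have hint : IntegrableOn (fun r : ℝ => Real.exp (-r) * r ^ (-μ.re)) (Set.Ioi a) := by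
    refine integrable_of_isBigO_exp_neg (b := 1 / 2) (by norm_num) ?_ ?_
    · refine ContinuousOn.mul (by fun_prop) ?_
      exact continuousOn_id.rpow_const fun r hr => Or.inl (lt_of_lt_of_le ha hr).ne'
    · have := Real.Gamma_integrand_isLittleO (-μ.re)
      refine (this.isBigO).congr (fun r => ?_) (fun r => ?_) <;> simp
  set J := ∫ r in Set.Ioi a, Real.exp (-r) * r ^ (-μ.re) with hJ
  refine ⟨Real.exp a * a ^ (1 - μ.re) * Real.exp (π * |μ.im|) * (2 * π) +
    2 * Real.exp (π * |μ.im|) * J, fun κ hκ b hab => ?_⟩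
  have h0 := hankelArc_sub (μ + κ) ha hab
  have h1 := norm_hankelArc_le (μ + κ) ha
  have him : (μ + κ).im = μ.im := by simp
  have hre : (μ + κ).re = μ.re + κ := by simp
  rw [him, hre, show 1 - (μ.re + κ) = (1 - μ.re) + (-κ) by ring, Real.rpow_add ha] at h1
  have h2 : ‖∫ r in a..b, (Real.exp (-r) : ℂ) * (r : ℂ) ^ (-(μ + κ))‖ ≤ a ^ (-κ) * J := by
    have hle : ∀ r ∈ Set.Ioi a, ‖(Real.exp (-r) : ℂ) * (r : ℂ) ^ (-(μ + κ))‖ ≤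
        a ^ (-κ) * (Real.exp (-r) * r ^ (-μ.re)) := by
      intro r hr
      have hr0 : 0 < r := ha.trans hr
      rw [norm_mul, Complex.norm_real, Complex.norm_cpow_eq_rpow_re_of_pos hr0, Real.norm_eq_abs,
        Real.abs_exp, Complex.neg_re, hre, neg_add, Real.rpow_add hr0, mul_comm (r ^ _),
        mul_left_comm]
      gcongr ?_ * _
      exact Real.rpow_le_rpow_of_nonpos ha (le_of_lt hr) (by linarith)
    rw [intervalIntegral.integral_of_le hab, hJ, ← MeasureTheory.integral_const_mul]
    refine (norm_integral_le_integral_norm _).trans ?_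
    have hI : IntegrableOn (fun r : ℝ => a ^ (-κ) * (Real.exp (-r) * r ^ (-μ.re))) (Set.Ioi a) :=
      hint.const_mul (a ^ (-κ))
    calc _ ≤ ∫ r in Set.Ioc a b, a ^ (-κ) * (Real.exp (-r) * r ^ (-μ.re)) := by
          refine integral_mono_of_nonneg (Filter.Eventually.of_forall fun _ => norm_nonneg _)
            (hI.mono_set Set.Ioc_subset_Ioi_self) ?_
          filter_upwards [ae_restrict_mem measurableSet_Ioc] with r hr using hle r hr.1
      _ ≤ _ := by
          refine setIntegral_mono_set hI ?_ Set.Ioc_subset_Ioi_self.eventuallyLE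
          filter_upwards [ae_restrict_mem measurableSet_Ioi] with r hr
          have hr0 : 0 < r := ha.trans hr
          simp only [Pi.zero_apply]
          positivity
  have h3 : ∀ c : ℂ, c.re ≤ π * |μ.im| → ‖Complex.exp c‖ ≤ Real.exp (π * |μ.im|) := by
    intro c hc
    rw [Complex.norm_exp]
    exact Real.exp_le_exp.2 hc
  have h4 : ‖Complex.exp (π * Complex.I * (1 - (μ + κ))) -
      Complex.exp (-(π * Complex.I * (1 - (μ + κ))))‖ ≤ 2 * Real.exp (π * |μ.im|) := by
    refine (norm_sub_le _ _).trans ?_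
    rw [two_mul]
    refine add_le_add (h3 _ ?_) (h3 _ ?_) <;> simp <;>
      nlinarith [le_abs_self μ.im, neg_abs_le μ.im, Real.pi_pos]
  have h5 : ‖hankelArc (μ + κ) b - hankelArc (μ + κ) a‖ ≤
      2 * Real.exp (π * |μ.im|) * (a ^ (-κ) * J) := by
    have : ‖hankelArc (μ + κ) b - hankelArc (μ + κ) a‖ =
      ‖Complex.I * (hankelArc (μ + κ) b - hankelArc (μ + κ) a)‖ := by simp
    rw [this, h0, norm_mul]
    gcongr
  have h6 := norm_sub_norm_le (hankelArc (μ + κ) b) (hankelArc (μ + κ) a)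
  linarith

/-- Here the kernel is `exp (exp s)`, so the arc is `2π` times the mean value of `exp` over a
circle. This case is needed separately because the recurrence from `w` to `w + 1` divides by `w`. -/
theorem hankelArc_one (b : ℝ) (hb : 0 < b) : hankelArc 1 b = 2 * π := by
  have h := Complex.circleIntegral_sub_inv_smul_of_differentiable_on_off_countable (R := b) (c := 0)
    (w := 0) (f := Complex.exp) Set.countable_empty (by simpa using hb) (by fun_prop)
    (fun _ _ => Complex.differentiable_exp.differentiableAt)
  have hper : Function.Periodic (fun θ : ℝ => Complex.exp (b * Complex.exp (θ * Complex.I)))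
      (2 * π) := by
    intro θ
    simp only
    push_cast
    rw [add_mul, Complex.exp_periodic]
  have h1 : hankelArc 1 b = ∫ θ in (-π)..π, Complex.exp (b * Complex.exp (θ * Complex.I)) := by
    refine intervalIntegral.integral_congr fun θ _ => ?_
    simp [hankelKernel, exp_log_add_mul_I hb]
  have h2 := hper.intervalIntegral_add_eq (-π) 0
  rw [show -π + 2 * π = π by ring, zero_add] at h2
  rw [h1, h2]
  rw [circleIntegral] at h
  have h3 : ∫ θ in (0 : ℝ)..2 * π, deriv (circleMap 0 b) θ •
      ((circleMap 0 b θ - 0)⁻¹ • Complex.exp (circleMap 0 b θ)) =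
      Complex.I * ∫ θ in (0 : ℝ)..2 * π, Complex.exp (b * Complex.exp (θ * Complex.I)) := by
    rw [← intervalIntegral.integral_const_mul]
    refine intervalIntegral.integral_congr fun θ _ => ?_
    have hb' : (b : ℂ) ≠ 0 := by exact_mod_cast hb.ne'
    have := Complex.exp_ne_zero (θ * Complex.I)
    simp only [deriv_circleMap, circleMap_zero, smul_eq_mul, sub_zero]
    field_simp
  rw [h3] at h
  simp only [Complex.exp_zero, smul_eq_mul, mul_one] at h
  exact mul_left_cancel₀ Complex.I_ne_zero (by rw [h]; ring)

/-- For `Re ν < 1` the inner circle can be shrunk to the origin. What remains is the integral over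
the two edges of the cut, which tends to a multiple of `Γ(1 - ν)`, and the reflection formula
converts this into `1 / Γ(ν)`. -/
theorem tendsto_hankelArc_of_re_lt_one {ν : ℂ} (hν : ν.re < 1) :
    Filter.Tendsto (hankelArc ν) Filter.atTop (nhds (2 * π / Complex.Gamma ν)) := by
  have hint : IntegrableOn (fun r : ℝ => (Real.exp (-r) : ℂ) * (r : ℂ) ^ (-ν)) (Set.Ioi 0) := by
    have := Complex.GammaIntegral_convergent (s := 1 - ν) (by simpa using hν)
    simpa using this
  have hval : ∫ r in Set.Ioi (0 : ℝ), (Real.exp (-r) : ℂ) * (r : ℂ) ^ (-ν) =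
      Complex.Gamma (1 - ν) := by
    rw [Complex.Gamma_eq_integral (by simpa using hν), Complex.GammaIntegral]
    simp
  have hzero : Filter.Tendsto (hankelArc ν) (nhdsWithin 0 (Set.Ioi 0)) (nhds 0) := by
    have hlim : Filter.Tendsto (fun b : ℝ => Real.exp b * b ^ (1 - ν.re) *
        Real.exp (π * |ν.im|) * (2 * π)) (nhdsWithin 0 (Set.Ioi 0)) (nhds 0) := by
      have h0 : ContinuousAt (fun b : ℝ => Real.exp b * b ^ (1 - ν.re) *
        Real.exp (π * |ν.im|) * (2 * π)) 0 := by
        have : ContinuousAt (fun b : ℝ => b ^ (1 - ν.re)) 0 :=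
          Real.continuousAt_rpow_const _ _ (Or.inr (by linarith))
        fun_prop
      have h1 := h0.tendsto
      simp only [Real.zero_rpow (show 1 - ν.re ≠ 0 by linarith), mul_zero, zero_mul] at h1
      exact h1.mono_left nhdsWithin_le_nhds
    refine squeeze_zero_norm' ?_ hlim
    filter_upwards [self_mem_nhdsWithin] with b hb using norm_hankelArc_le ν hb
  set S := Complex.exp (π * Complex.I * (1 - ν)) - Complex.exp (-(π * Complex.I * (1 - ν))) with hS
  have hformula : ∀ b : ℝ, 0 < b → Complex.I * hankelArc ν b =
      S * ∫ r in (0 : ℝ)..b, (Real.exp (-r) : ℂ) * (r : ℂ) ^ (-ν) := by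
    intro b hb
    have hib : ∀ c d : ℝ, 0 ≤ c → 0 ≤ d → IntervalIntegrable
        (fun r : ℝ => (Real.exp (-r) : ℂ) * (r : ℂ) ^ (-ν)) volume c d := by
      intro c d hc hd
      rw [intervalIntegrable_iff]
      exact hint.mono_set fun x hx => lt_of_le_of_lt (le_min hc hd) hx.1
    have hA : Filter.Tendsto (fun a : ℝ => Complex.I * (hankelArc ν b - hankelArc ν a))
        (nhdsWithin 0 (Set.Ioi 0)) (nhds (Complex.I * (hankelArc ν b - 0))) :=
      (tendsto_const_nhds.sub hzero).const_mul _
    have hB : Filter.Tendsto (fun a : ℝ => S * ∫ r in a..b, (Real.exp (-r) : ℂ) * (r : ℂ) ^ (-ν))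
        (nhdsWithin 0 (Set.Ioi 0))
        (nhds (S * ∫ r in (0 : ℝ)..b, (Real.exp (-r) : ℂ) * (r : ℂ) ^ (-ν))) := by
      have hc : ContinuousWithinAt
          (fun a : ℝ => ∫ r in a..b, (Real.exp (-r) : ℂ) * (r : ℂ) ^ (-ν)) (Set.Icc 0 b) 0 := by
        have := intervalIntegral.continuousOn_primitive_interval_left
          (f := fun r : ℝ => (Real.exp (-r) : ℂ) * (r : ℂ) ^ (-ν)) (a := 0) (b := b) (μ := volume)
          (by rw [Set.uIcc_of_le hb.le, integrableOn_Icc_iff_integrableOn_Ioc]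
              exact hint.mono_set Set.Ioc_subset_Ioi_self)
        rw [Set.uIcc_of_le hb.le] at this
        exact this 0 (Set.left_mem_Icc.2 hb.le)
      refine (hc.tendsto.mono_left ?_).const_mul _
      rw [← nhdsWithin_Ioc_eq_nhdsGT hb]
      exact nhdsWithin_mono _ Set.Ioc_subset_Icc_self
    have hAB := tendsto_nhds_unique (hA.congr' ?_) hB
    · simpa using hAB
    · filter_upwards [Ioo_mem_nhdsGT hb] with a ha
      exact hankelArc_sub ν ha.1 ha.2.le
  have hT : Filter.Tendsto (fun b : ℝ => -Complex.I * (S *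
      ∫ r in (0 : ℝ)..b, (Real.exp (-r) : ℂ) * (r : ℂ) ^ (-ν))) Filter.atTop
      (nhds (-Complex.I * (S * Complex.Gamma (1 - ν)))) := by
    rw [← hval]
    exact ((intervalIntegral_tendsto_integral_Ioi 0 hint Filter.tendsto_id).const_mul _).const_mul _
  have hS2 : S = 2 * Complex.I * Complex.sin (π * ν) := by
    have : Complex.sin (π * ν) = Complex.sin (π * (1 - ν)) := by
      rw [mul_sub, mul_one, Complex.sin_pi_sub]
    rw [this, Complex.sin, hS]
    have hI := Complex.I_mul_I
    rw [show π * Complex.I * (1 - ν) = π * (1 - ν) * Complex.I by ring,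
      show -(π * (1 - ν) * Complex.I) = -(π * (1 - ν)) * Complex.I by ring]
    linear_combination (Complex.exp (π * (1 - ν) * Complex.I)
      - Complex.exp (-(π * (1 - ν)) * Complex.I)) * hI
  have hlimval : -Complex.I * (S * Complex.Gamma (1 - ν)) = 2 * π / Complex.Gamma ν := by
    rw [hS2]
    have href := Complex.Gamma_mul_Gamma_one_sub ν
    have h1 : -Complex.I * (2 * Complex.I * Complex.sin (π * ν) * Complex.Gamma (1 - ν)) =
        2 * (Complex.sin (π * ν) * Complex.Gamma (1 - ν)) := by
      linear_combination (-2 * (Complex.sin (π * ν) * Complex.Gamma (1 - ν))) * Complex.I_mul_I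
    rw [h1]
    have hg1 : Complex.Gamma (1 - ν) ≠ 0 :=
      Complex.Gamma_ne_zero_of_re_pos (by simpa using hν)
    -- When the sine vanishes, the right side of the reflection formula is `π / 0 = 0`; since `Γ(1 -
    -- ν) ≠ 0`, this forces `Gamma ν = 0`, and both sides of the goal are `0`.
    by_cases hs : Complex.sin (π * ν) = 0
    · rw [hs, div_zero] at href
      rcases mul_eq_zero.1 href with h | h
      · simp [hs, h]
      · exact absurd h hg1
    · have hpi : (π : ℂ) ≠ 0 := by exact_mod_cast Real.pi_ne_zero
      have hg : Complex.Gamma ν ≠ 0 := by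
        intro h
        rw [h, zero_mul, eq_comm, div_eq_zero_iff] at href
        tauto
      rw [eq_div_iff hg]
      rw [eq_div_iff hs] at href
      linear_combination 2 * href
  rw [← hlimval]
  refine hT.congr' ?_
  filter_upwards [Filter.eventually_gt_atTop 0] with b hb
  rw [← hformula b hb]
  linear_combination (-hankelArc ν b) * Complex.I_mul_I

/-- Integration by parts for Hankel's integral. -/
theorem hankelArc_recurrence (ν : ℂ) {b : ℝ} (hb : 0 < b) :
    Complex.I * (hankelArc ν b - ν * hankelArc (ν + 1) b) =
      Complex.exp (-b - ν * Real.log b) *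
        (Complex.exp (-(ν * (π * Complex.I))) - Complex.exp (ν * (π * Complex.I))) := by
  have hc := fun ν => (differentiable_hankelKernel ν).continuous
  have hi : ∀ ν : ℂ, IntervalIntegrable
      (fun θ : ℝ => hankelKernel ν ((Real.log b : ℂ) + θ * Complex.I)) volume (-π) π := fun ν => by
    have := hc ν
    exact Continuous.intervalIntegrable (by fun_prop) _ _
  -- The function integrated by parts is `exp (e^s - ν s)`; at `θ = ±π` one has `e^s = -b`, so the
  -- boundary terms decay exponentially.
  have hD : ∀ s, HasDerivAt (fun s => Complex.exp (Complex.exp s) * Complex.exp (-(ν * s)))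
      (hankelKernel ν s - ν * hankelKernel (ν + 1) s) s := by
    intro s
    have h1 := (Complex.hasDerivAt_exp s).cexp
    have h2 : HasDerivAt (fun s => Complex.exp (-(ν * s))) (Complex.exp (-(ν * s)) * -ν) s := by
      have h := ((hasDerivAt_id s).const_mul ν).neg.cexp
      rw [mul_one] at h
      exact h
    refine (h1.mul h2).congr_deriv ?_
    simp only [hankelKernel]
    rw [show (1 - ν) * s = s + -(ν * s) by ring, Complex.exp_add,
      show (1 - (ν + 1)) * s = -(ν * s) by ring]
    ring
  have hI := integral_comp_mul_deriv_of_primitive (a := -π) (b := π)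
    (F := fun s => Complex.exp (Complex.exp s) * Complex.exp (-(ν * s)))
    (f := fun s => hankelKernel ν s - ν * hankelKernel (ν + 1) s)
    (fun t _ => hasDerivAt_vertical (Real.log b) t) (fun t _ => hD _) (by
      have h1 := hc ν
      have h2 := hc (ν + 1)
      exact Continuous.intervalIntegrable (by fun_prop) _ _)
  rw [intervalIntegral.integral_mul_const, intervalIntegral.integral_sub (hi ν)
    ((hi (ν + 1)).const_mul ν), intervalIntegral.integral_const_mul] at hI
  rw [← hankelArc, ← hankelArc, mul_comm] at hI
  rw [hI, exp_log_add_mul_I hb, exp_log_add_mul_I hb, Complex.exp_pi_mul_I]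
  have : Complex.exp (((-π : ℝ) : ℂ) * Complex.I) = -1 := by
    rw [Complex.ofReal_neg, neg_mul, Complex.exp_neg, Complex.exp_pi_mul_I]; norm_num
  rw [this, ← Complex.exp_add, ← Complex.exp_add, mul_sub, ← Complex.exp_add, ← Complex.exp_add]
  congr 2
  · ring
  · push_cast; ring

/-- **Hankel's formula**: the integrals over the circles converge to `2π / Γ(ν)`. -/
theorem tendsto_hankelArc (ν : ℂ) :
    Filter.Tendsto (hankelArc ν) Filter.atTop (nhds (2 * π / Complex.Gamma ν)) := by
  obtain ⟨n, hn⟩ := exists_nat_gt ν.re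
  have hn' : ν.re < n + 1 := by linarith
  clear hn
  -- Each step moves the half-plane `Re ν < n + 1` one unit to the right through `Γ(w + 1) = w Γ(w)`
  -- and integration by parts.
  induction n generalizing ν with
  | zero => exact tendsto_hankelArc_of_re_lt_one (by simpa using hn')
  | succ n ih =>
    by_cases h1 : ν = 1
    · subst h1
      rw [Complex.Gamma_one, div_one]
      refine tendsto_const_nhds.congr' ?_
      filter_upwards [Filter.eventually_gt_atTop 0] with b hb using (hankelArc_one b hb).symm
    · obtain ⟨w, rfl⟩ : ∃ w, ν = w + 1 := ⟨ν - 1, by ring⟩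
      have hw : w ≠ 0 := fun h => h1 (by rw [h, zero_add])
      have hlim := ih w (by simp at hn'; linarith)
      have hsmall : Filter.Tendsto (fun b : ℝ => Complex.exp (-b - w * Real.log b) *
          (Complex.exp (-(w * (π * Complex.I))) - Complex.exp (w * (π * Complex.I))))
          Filter.atTop (nhds 0) := by
        rw [← zero_mul (Complex.exp (-(w * (π * Complex.I))) - Complex.exp (w * (π * Complex.I)))]
        refine Filter.Tendsto.mul_const _ ?_
        rw [tendsto_zero_iff_norm_tendsto_zero]
        have h2 := tendsto_rpow_mul_exp_neg_mul_atTop_nhds_zero (-w.re) 1 one_pos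
        refine h2.congr' ?_
        filter_upwards [Filter.eventually_gt_atTop 0] with b hb
        rw [Complex.norm_exp, Real.rpow_def_of_pos hb, ← Real.exp_add]
        congr 1
        simp
        ring
      rw [Complex.Gamma_add_one w hw]
      have h3 := (hlim.add (hsmall.const_mul Complex.I)).const_mul w⁻¹
      rw [mul_zero, add_zero] at h3
      have e : w⁻¹ * (2 * π / Complex.Gamma w) = 2 * π / (w * Complex.Gamma w) := by
        rw [mul_comm, ← div_eq_mul_inv, div_div, mul_comm w]
      rw [e] at h3
      refine h3.congr' ?_
      filter_upwards [Filter.eventually_gt_atTop 0] with b hb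
      rw [← hankelArc_recurrence w hb]
      field_simp
      linear_combination (hankelArc w b - w * hankelArc (w + 1) b) * Complex.I_sq

/-! ### The Mittag-Leffler function as a limit of arc integrals. -/

/-- The integrand of the contour integral for `E_{ρ,μ}(z)` in the logarithmic coordinate. -/
noncomputable def mlIntegrand (ρ : ℝ) (μ z s : ℂ) : ℂ :=
  Complex.exp (Complex.exp (ρ * s)) * Complex.exp (ρ * (1 - μ) * s) *
    (Complex.exp s / (Complex.exp s - z))

theorem norm_exp_log_add_mul_I {b : ℝ} (hb : 0 < b) (θ : ℝ) :
    ‖Complex.exp ((Real.log b : ℂ) + θ * Complex.I)‖ = b := by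
  rw [exp_log_add_mul_I hb, norm_mul, Complex.norm_exp_ofReal_mul_I, Complex.norm_real,
    Real.norm_of_nonneg hb.le, mul_one]

theorem exp_log_add_mul_I_sub_ne_zero {z : ℂ} {b : ℝ} (hb : 0 < b) (hz : b ≠ ‖z‖) (θ : ℝ) :
    Complex.exp ((Real.log b : ℂ) + θ * Complex.I) - z ≠ 0 := by
  intro h
  rw [sub_eq_zero] at h
  exact hz (by rw [← h, norm_exp_log_add_mul_I hb])

theorem continuous_mlIntegrand_vertical (ρ : ℝ) (μ : ℂ) {z : ℂ} {b : ℝ} (hb : 0 < b)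
    (hz : b ≠ ‖z‖) :
    Continuous fun θ : ℝ => mlIntegrand ρ μ z ((Real.log b : ℂ) + θ * Complex.I) := by
  unfold mlIntegrand
  refine Continuous.mul (by fun_prop) (Continuous.div (by fun_prop) (by fun_prop) ?_)
  exact exp_log_add_mul_I_sub_ne_zero hb hz

/-- This is the geometric series of `z / exp s`: dividing by `exp (k s)` is the same as raising the
Hankel parameter by `k / ρ` at the point `ρ s`. -/
theorem hasSum_mlIntegrand {ρ : ℝ} (hρ : 0 < ρ) (μ : ℂ) {z s : ℂ} (h : ‖z‖ < ‖Complex.exp s‖) :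
    HasSum (fun k : ℕ => z ^ k * hankelKernel (μ + k / ρ) (ρ * s)) (mlIntegrand ρ μ z s) := by
  have hes := Complex.exp_ne_zero s
  have hlt : ‖z / Complex.exp s‖ < 1 := by
    rw [norm_div, div_lt_one (norm_pos_iff.2 hes)]; exact h
  have h1 := (hasSum_geometric_of_norm_lt_one hlt).mul_left
    (Complex.exp (Complex.exp (ρ * s)) * Complex.exp (ρ * (1 - μ) * s))
  have h2 : (1 - z / Complex.exp s)⁻¹ = Complex.exp s / (Complex.exp s - z) := by
    rw [one_sub_div hes, inv_div]
  rw [h2] at h1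
  refine h1.congr_fun fun k => ?_
  have hρ' : (ρ : ℂ) ≠ 0 := by exact_mod_cast hρ.ne'
  rw [hankelKernel, show (1 - (μ + k / ρ)) * (ρ * s) = ρ * (1 - μ) * s - k * s by field_simp; ring,
    Complex.exp_sub, Complex.exp_nat_mul, div_pow]
  ring

/-- Multiplication of the logarithmic coordinate by `ρ` opens the arc `|θ| ≤ π/ρ` of radius `b` into
a full circle of radius `b ^ ρ`. -/
theorem integral_hankelKernel_comp_mul {ρ : ℝ} (hρ : 0 < ρ) (ν : ℂ) {b : ℝ} (hb : 0 < b) :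
    ∫ θ in (-(π / ρ))..(π / ρ), hankelKernel ν (ρ * ((Real.log b : ℂ) + θ * Complex.I)) =
      (ρ : ℂ)⁻¹ * hankelArc ν (b ^ ρ) := by
  have h := intervalIntegral.integral_comp_mul_left (a := -(π / ρ)) (b := π / ρ)
    (fun θ : ℝ => hankelKernel ν ((Real.log (b ^ ρ) : ℂ) + θ * Complex.I)) hρ.ne'
  rw [show ρ * -(π / ρ) = -π by field_simp, show ρ * (π / ρ) = π by field_simp, ← hankelArc,
    Complex.real_smul, Complex.ofReal_inv] at h
  rw [← h]
  refine intervalIntegral.integral_congr fun θ _ => ?_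
  simp only [Real.log_rpow hb]
  congr 1
  push_cast
  ring

theorem hasSum_integral_mlIntegrand {ρ : ℝ} (hρ : 0 < ρ) (μ : ℂ) {z : ℂ} {b : ℝ} (hb : ‖z‖ < b) :
    HasSum (fun k : ℕ => z ^ k * ((ρ : ℂ)⁻¹ * hankelArc (μ + k / ρ) (b ^ ρ)))
      (∫ θ in (-(π / ρ))..(π / ρ), mlIntegrand ρ μ z ((Real.log b : ℂ) + θ * Complex.I)) := by
  have hb0 : 0 < b := (norm_nonneg z).trans_lt hb
  have hπ : 0 < π / ρ := by positivity
  have hρ' : (ρ : ℂ) ≠ 0 := by exact_mod_cast hρ.ne'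
  let f : ℕ → C(ℝ, ℂ) := fun k =>
    ⟨fun θ => z ^ k * hankelKernel (μ + k / ρ) (ρ * ((Real.log b : ℂ) + θ * Complex.I)), by
      have := (differentiable_hankelKernel (μ + k / ρ)).continuous
      fun_prop⟩
  let g : C(ℝ, ℂ) := ⟨fun θ => hankelKernel μ (ρ * ((Real.log b : ℂ) + θ * Complex.I)), by
      have := (differentiable_hankelKernel μ).continuous
      fun_prop⟩
  -- The `k`-th term differs from the zeroth by the factor `(z / exp s)^k`, whose modulus does not
  -- depend on the angle; this gives a geometric majorant in sup norm.
  have hfg : ∀ k θ, ‖f k θ‖ = (‖z‖ / b) ^ k * ‖g θ‖ := by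
    intro k θ
    simp only [f, g, ContinuousMap.coe_mk, hankelKernel, norm_mul, norm_pow]
    rw [show (1 - (μ + k / ρ)) * (ρ * ((Real.log b : ℂ) + θ * Complex.I)) =
      (1 - μ) * (ρ * ((Real.log b : ℂ) + θ * Complex.I)) -
        k * ((Real.log b : ℂ) + θ * Complex.I) by field_simp; ring,
      Complex.exp_sub, Complex.exp_nat_mul, norm_div, norm_pow, norm_exp_log_add_mul_I hb0, div_pow]
    ring
  have hsum : Summable fun k => ‖(f k).restrict (⟨Set.uIcc (-(π / ρ)) (π / ρ), isCompact_uIcc⟩ :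
      TopologicalSpace.Compacts ℝ)‖ := by
    set K : TopologicalSpace.Compacts ℝ := ⟨Set.uIcc (-(π / ρ)) (π / ρ), isCompact_uIcc⟩
    refine Summable.of_nonneg_of_le (fun _ => norm_nonneg _)
      (f := fun k => (‖z‖ / b) ^ k * ‖g.restrict K‖) (fun k => ?_)
      ((summable_geometric_of_lt_one (by positivity) ((div_lt_one hb0).2 hb)).mul_right _)
    rw [ContinuousMap.norm_le _ (by positivity)]
    intro x
    have h1 := (g.restrict K).norm_coe_le_norm x
    rw [ContinuousMap.restrict_apply, hfg]
    rw [ContinuousMap.restrict_apply] at h1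
    gcongr
  have h := intervalIntegral.hasSum_intervalIntegral_of_summable_norm hsum
  have hR : ∀ θ : ℝ, ∑' k, f k θ =
      mlIntegrand ρ μ z ((Real.log b : ℂ) + θ * Complex.I) := fun θ =>
    (hasSum_mlIntegrand hρ μ (by rwa [norm_exp_log_add_mul_I hb0])).tsum_eq
  simp only [hR] at h
  refine h.congr_fun fun k => ?_
  rw [← integral_hankelKernel_comp_mul hρ _ hb0, ← intervalIntegral.integral_const_mul]
  rfl

theorem exists_norm_hankelArc_term_le {ρ : ℝ} (hρ : 0 < ρ) (μ z : ℂ) :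
    ∃ B : ℕ → ℝ, Summable B ∧ ∀ b : ℝ, ‖z‖ + 1 ≤ b → ∀ k : ℕ,
      ‖z ^ k * ((ρ : ℂ)⁻¹ * hankelArc (μ + k / ρ) (b ^ ρ))‖ ≤ B k := by
  -- The reference radius `(‖z‖ + 1) ^ ρ` turns the bound `a ^ (-(k/ρ))` into `(‖z‖ + 1) ^ (-k)`,
  -- which beats `‖z‖ ^ k` geometrically.
  have hz1 : 0 < ‖z‖ + 1 := by positivity
  obtain ⟨C, hC⟩ := exists_norm_hankelArc_le μ (a := (‖z‖ + 1) ^ ρ) (by positivity)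
  refine ⟨fun k => (‖z‖ / (‖z‖ + 1)) ^ k * (ρ⁻¹ * C),
    (summable_geometric_of_lt_one (by positivity) ((div_lt_one hz1).2 (by linarith))).mul_right _,
    fun b hb k => ?_⟩
  have h := hC (k / ρ) (by positivity) (b ^ ρ) (Real.rpow_le_rpow hz1.le hb hρ.le)
  rw [← Real.rpow_mul hz1.le, show ρ * -(k / ρ) = -(k : ℝ) by field_simp, Real.rpow_neg hz1.le,
    Real.rpow_natCast] at h
  push_cast at h
  rw [norm_mul, norm_pow, norm_mul, norm_inv, Complex.norm_real, Real.norm_of_nonneg hρ.le]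
  calc _ ≤ ‖z‖ ^ k * (ρ⁻¹ * (C * ((‖z‖ + 1) ^ k)⁻¹)) := by gcongr
    _ = _ := by simp only [div_pow]; ring

theorem tendsto_hankelArc_term {ρ : ℝ} (hρ : 0 < ρ) (μ z : ℂ) (k : ℕ) :
    Filter.Tendsto (fun b : ℝ => z ^ k * ((ρ : ℂ)⁻¹ * hankelArc (μ + k / ρ) (b ^ ρ)))
      Filter.atTop (nhds (2 * π / ρ * mlTerm ρ μ z k)) := by
  have h := (((tendsto_hankelArc (μ + k / ρ)).comp (tendsto_rpow_atTop hρ)).const_mul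
    (ρ : ℂ)⁻¹).const_mul (z ^ k)
  have e : z ^ k * ((ρ : ℂ)⁻¹ * (2 * π / Complex.Gamma (μ + k / ρ))) =
      2 * π / ρ * mlTerm ρ μ z k := by rw [mlTerm]; ring
  rw [← e]
  exact h

/-- No asymptotics of `Γ` are needed: up to a constant, the terms are limits of Hankel terms that
share one summable bound. -/
theorem summable_mlTerm {ρ : ℝ} (hρ : 0 < ρ) (μ z : ℂ) : Summable (mlTerm ρ μ z) := by
  obtain ⟨B, hB, hle⟩ := exists_norm_hankelArc_term_le hρ μ z
  have hc : (2 * π / ρ : ℂ) ≠ 0 := by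
    have h1 : (ρ : ℂ) ≠ 0 := by exact_mod_cast hρ.ne'
    have h2 : (π : ℂ) ≠ 0 := by exact_mod_cast Real.pi_ne_zero
    exact div_ne_zero (mul_ne_zero two_ne_zero h2) h1
  rw [← summable_mul_left_iff hc]
  refine Summable.of_norm_bounded hB fun k => ?_
  refine le_of_tendsto (tendsto_hankelArc_term hρ μ z k).norm ?_
  filter_upwards [Filter.eventually_ge_atTop (‖z‖ + 1)] with b hb using hle b hb k

theorem tendsto_integral_mlIntegrand_pi_div {ρ : ℝ} (hρ : 0 < ρ) (μ z : ℂ) :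
    Filter.Tendsto (fun b : ℝ => ∫ θ in (-(π / ρ))..(π / ρ),
      mlIntegrand ρ μ z ((Real.log b : ℂ) + θ * Complex.I)) Filter.atTop
      (nhds (2 * π / ρ * mlE ρ μ z)) := by
  obtain ⟨B, hB, hle⟩ := exists_norm_hankelArc_term_le hρ μ z
  have h := tendsto_tsum_of_dominated_convergence hB (tendsto_hankelArc_term hρ μ z)
    (by filter_upwards [Filter.eventually_ge_atTop (‖z‖ + 1)] with b hb using hle b hb)
  rw [tsum_mul_left] at h
  refine h.congr' ?_
  filter_upwards [Filter.eventually_gt_atTop ‖z‖] with b hb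
  exact (hasSum_integral_mlIntegrand hρ μ hb).tsum_eq

/-- The bounds `c` on the cosine and `T` on the angle stay free, so that the estimate serves large
arcs, small arcs and single rays alike. -/
theorem norm_mlIntegrand_le {ρ : ℝ} (hρ : 0 < ρ) (μ z : ℂ) {b θ c T : ℝ} (hb : 0 < b)
    (hc : Real.cos (ρ * θ) ≤ c) (hT : |θ| ≤ T) :
    ‖mlIntegrand ρ μ z ((Real.log b : ℂ) + θ * Complex.I)‖ ≤
      Real.exp (c * b ^ ρ) * b ^ (ρ * (1 - μ.re)) * Real.exp (ρ * |μ.im| * T) *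
        (b / ‖Complex.exp ((Real.log b : ℂ) + θ * Complex.I) - z‖) := by
  rw [mlIntegrand, norm_mul, norm_div, norm_exp_log_add_mul_I hb]
  gcongr
  rw [norm_mul, Complex.norm_exp, Complex.norm_exp, mul_assoc (Real.exp (c * b ^ ρ))]
  gcongr
  · have : (ρ : ℂ) * ((Real.log b : ℂ) + θ * Complex.I) =
        (Real.log (b ^ ρ) : ℂ) + (ρ * θ : ℝ) * Complex.I := by
      rw [Real.log_rpow hb]; push_cast; ring
    rw [this, exp_log_add_mul_I (by positivity), Complex.re_ofReal_mul,
      Complex.exp_ofReal_mul_I_re, mul_comm]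
    gcongr
  · rw [Real.rpow_def_of_pos hb, ← Real.exp_add]
    gcongr
    have : μ.im * θ ≤ |μ.im| * T := by
      calc μ.im * θ ≤ |μ.im * θ| := le_abs_self _
        _ = |μ.im| * |θ| := abs_mul _ _
        _ ≤ _ := by gcongr
    simp
    nlinarith

theorem tendsto_integral_mlIntegrand_zero {ρ : ℝ} (hρ : 0 < ρ) (μ z : ℂ) {α β : ℝ}
    (h : ∀ θ ∈ Set.uIcc α β, Real.cos (ρ * θ) < 0) :
    Filter.Tendsto (fun b : ℝ => ∫ θ in α..β,
      mlIntegrand ρ μ z ((Real.log b : ℂ) + θ * Complex.I)) Filter.atTop (nhds 0) := by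
  obtain ⟨θ₀, hθ₀, hmax⟩ := (isCompact_uIcc (a := α) (b := β)).exists_isMaxOn
    Set.nonempty_uIcc (f := fun θ => Real.cos (ρ * θ)) (by fun_prop)
  have hc : 0 < -Real.cos (ρ * θ₀) := neg_pos.2 (h θ₀ hθ₀)
  set c := -Real.cos (ρ * θ₀) with hcdef
  have hlim : Filter.Tendsto (fun b : ℝ => Real.exp (-c * b ^ ρ) * b ^ (ρ * (1 - μ.re)) *
      Real.exp (ρ * |μ.im| * (|α| + |β|)) * 2 * |β - α|) Filter.atTop (nhds 0) := by
    have h1 := (tendsto_rpow_mul_exp_neg_mul_atTop_nhds_zero (1 - μ.re) c hc).comp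
      (tendsto_rpow_atTop hρ)
    have h2 := ((h1.mul_const (Real.exp (ρ * |μ.im| * (|α| + |β|)))).mul_const 2).mul_const |β - α|
    simp only [zero_mul] at h2
    refine h2.congr' ?_
    filter_upwards [Filter.eventually_gt_atTop 0] with b hb
    simp only [Function.comp]
    rw [← Real.rpow_mul hb.le]
    ring
  refine squeeze_zero_norm' ?_ hlim
  -- For such `b`, the factor `b / ‖exp s - z‖` is at most `2`.
  filter_upwards [Filter.eventually_ge_atTop (2 * ‖z‖ + 1)] with b hb
  have hz := norm_nonneg z
  have hb0 : 0 < b := by linarith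
  refine intervalIntegral.norm_integral_le_of_norm_le_const fun θ hθ => ?_
  have hθ' := Set.uIoc_subset_uIcc hθ
  have hT : |θ| ≤ |α| + |β| := by
    rcases Set.mem_uIcc.1 hθ' with h | h <;> rw [abs_le] <;> constructor <;>
      linarith [neg_abs_le α, neg_abs_le β, le_abs_self α, le_abs_self β, abs_nonneg α, abs_nonneg β]
  refine (norm_mlIntegrand_le hρ μ z hb0 (c := -c) (by rw [hcdef, neg_neg]; exact hmax hθ')
    hT).trans ?_
  gcongr
  have h1 := norm_sub_norm_le (Complex.exp ((Real.log b : ℂ) + θ * Complex.I)) z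
  rw [norm_exp_log_add_mul_I hb0] at h1
  rw [div_le_iff₀ (by linarith)]
  linarith

theorem tendsto_integral_mlIntegrand_nhdsGT_zero {ρ : ℝ} (hρ : 0 < ρ) {μ z : ℂ}
    (hμ : μ.re < 1 + 1 / ρ) (hz : z ≠ 0) (α β : ℝ) :
    Filter.Tendsto (fun b : ℝ => ∫ θ in α..β,
      mlIntegrand ρ μ z ((Real.log b : ℂ) + θ * Complex.I)) (nhdsWithin 0 (Set.Ioi 0)) (nhds 0) := by
  have hz0 : 0 < ‖z‖ := norm_pos_iff.2 hz
  -- This is where the bound on `Re μ` enters: near `w = 0` the integrand is of order `b ^ (ρ * (1 -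
  -- Re μ) + 1)`, the extra power coming from the numerator `exp s`.
  have hpos : 0 < ρ * (1 - μ.re) + 1 := by
    have h1 := mul_lt_mul_of_pos_left hμ hρ
    rw [mul_add, mul_one_div_cancel hρ.ne'] at h1
    linarith
  set E := Real.exp (ρ * |μ.im| * (|α| + |β|))
  have hlim : Filter.Tendsto (fun b : ℝ => Real.exp (1 * b ^ ρ) * b ^ (ρ * (1 - μ.re) + 1) *
      (E * (2 / ‖z‖) * |β - α|)) (nhdsWithin 0 (Set.Ioi 0)) (nhds 0) := by
    have h0 : ContinuousAt (fun b : ℝ => Real.exp (1 * b ^ ρ) * b ^ (ρ * (1 - μ.re) + 1) *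
      (E * (2 / ‖z‖) * |β - α|)) 0 := by
      have h1 : ContinuousAt (fun b : ℝ => b ^ (ρ * (1 - μ.re) + 1)) 0 :=
        Real.continuousAt_rpow_const _ _ (Or.inr hpos.le)
      have h2 : ContinuousAt (fun b : ℝ => b ^ ρ) 0 :=
        Real.continuousAt_rpow_const _ _ (Or.inr hρ.le)
      fun_prop
    have h1 := h0.tendsto
    simp only [Real.zero_rpow hpos.ne', mul_zero, zero_mul] at h1
    exact h1.mono_left nhdsWithin_le_nhds
  refine squeeze_zero_norm' ?_ hlim
  filter_upwards [Ioo_mem_nhdsGT (half_pos hz0)] with b hb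
  have hb0 : 0 < b := hb.1
  have hb2 : b < ‖z‖ / 2 := hb.2
  rw [← mul_assoc]
  refine intervalIntegral.norm_integral_le_of_norm_le_const fun θ hθ => ?_
  have hθ' := Set.uIoc_subset_uIcc hθ
  have hT : |θ| ≤ |α| + |β| := by
    rcases Set.mem_uIcc.1 hθ' with h | h <;> rw [abs_le] <;> constructor <;>
      linarith [neg_abs_le α, neg_abs_le β, le_abs_self α, le_abs_self β, abs_nonneg α, abs_nonneg β]
  refine (norm_mlIntegrand_le hρ μ z hb0 (Real.cos_le_one _) hT).trans ?_
  rw [Real.rpow_add hb0, Real.rpow_one]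
  have h1 := norm_sub_norm_le z (Complex.exp ((Real.log b : ℂ) + θ * Complex.I))
  rw [norm_exp_log_add_mul_I hb0, norm_sub_rev] at h1
  have h2 : b / ‖Complex.exp ((Real.log b : ℂ) + θ * Complex.I) - z‖ ≤ b * (2 / ‖z‖) := by
    rw [div_eq_mul_inv]
    gcongr
    rw [← inv_div]
    gcongr
    linarith
  calc _ ≤ Real.exp (1 * b ^ ρ) * b ^ (ρ * (1 - μ.re)) * E * (b * (2 / ‖z‖)) := by gcongr
    _ = _ := by ring

theorem cos_mul_neg_of_mem_uIcc {ρ α β θ : ℝ} (hρ : 0 < ρ)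
    (hα : α ∈ Set.Ioo (π / (2 * ρ)) (3 * π / (2 * ρ)))
    (hβ : β ∈ Set.Ioo (π / (2 * ρ)) (3 * π / (2 * ρ))) (hθ : θ ∈ Set.uIcc α β) :
    Real.cos (ρ * θ) < 0 := by
  have h := (Set.ordConnected_Ioo.uIcc_subset hα hβ) hθ
  obtain ⟨h1, h2⟩ := h
  rw [div_lt_iff₀ (by positivity)] at h1
  rw [lt_div_iff₀ (by positivity)] at h2
  refine Real.cos_neg_of_pi_div_two_lt_of_lt ?_ ?_ <;> linarith

/-- The Mittag-Leffler function is the limit of integrals over arcs of growing circles whose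
end points lie in the sectors where `exp (w ^ ρ)` decays. -/
theorem tendsto_integral_mlIntegrand {ρ : ℝ} (hρ : 0 < ρ) (μ z : ℂ) {α β : ℝ}
    (hα : -α ∈ Set.Ioo (π / (2 * ρ)) (3 * π / (2 * ρ)))
    (hβ : β ∈ Set.Ioo (π / (2 * ρ)) (3 * π / (2 * ρ))) :
    Filter.Tendsto (fun b : ℝ => ∫ θ in α..β,
      mlIntegrand ρ μ z ((Real.log b : ℂ) + θ * Complex.I)) Filter.atTop
      (nhds (2 * π / ρ * mlE ρ μ z)) := by
  have hmid : π / ρ ∈ Set.Ioo (π / (2 * ρ)) (3 * π / (2 * ρ)) := by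
    have := Real.pi_pos
    constructor
    · rw [div_lt_div_iff₀ (by positivity) hρ]; nlinarith [mul_pos this hρ]
    · rw [div_lt_div_iff₀ hρ (by positivity)]; nlinarith [mul_pos this hρ]
  -- The end points `±π/ρ` lie in the sectors of decay themselves, so passing to `α` and `β` costs
  -- two arcs on which the cosine stays negative.
  have h1 := tendsto_integral_mlIntegrand_zero hρ μ z (α := α) (β := -(π / ρ)) fun θ hθ => by
    rw [← Real.cos_neg, ← mul_neg]
    refine cos_mul_neg_of_mem_uIcc hρ hα hmid ?_
    rw [Set.mem_uIcc] at hθ ⊢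
    rcases hθ with h | h
    · right; constructor <;> linarith [h.1, h.2]
    · left; constructor <;> linarith [h.1, h.2]
  have h2 := tendsto_integral_mlIntegrand_zero hρ μ z (α := π / ρ) (β := β) fun θ hθ =>
    cos_mul_neg_of_mem_uIcc hρ hmid hβ hθ
  have h3 := (h1.add (tendsto_integral_mlIntegrand_pi_div hρ μ z)).add h2
  rw [zero_add, add_zero] at h3
  refine h3.congr' ?_
  filter_upwards [Filter.eventually_gt_atTop ‖z‖] with b hb
  have hc := continuous_mlIntegrand_vertical ρ μ ((norm_nonneg z).trans_lt hb) hb.ne'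
  rw [intervalIntegral.integral_add_adjacent_intervals (hc.intervalIntegrable _ _)
    (hc.intervalIntegrable _ _), intervalIntegral.integral_add_adjacent_intervals
    (hc.intervalIntegrable _ _) (hc.intervalIntegrable _ _)]

/-! ### The kernels as pullbacks of one holomorphic form. -/

/-- The logarithm whose imaginary part is the argument in `[0, 2π)`. -/
noncomputable def mlLog (z : ℂ) : ℂ := (Real.log ‖z‖ : ℂ) + mlArg z * Complex.I

theorem exp_mlLog {z : ℂ} (hz : z ≠ 0) : Complex.exp (mlLog z) = z := by
  rw [mlLog, exp_log_add_mul_I (norm_pos_iff.2 hz), mlArg]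
  split_ifs
  · exact Complex.norm_mul_exp_arg_mul_I z
  · rw [Complex.ofReal_add, add_mul, Complex.exp_add]
    push_cast
    rw [Complex.exp_two_pi_mul_I, mul_one]
    exact Complex.norm_mul_exp_arg_mul_I z

theorem mlPow_mul_ofReal {z : ℂ} (hz : z ≠ 0) {r : ℝ} (hr : 0 < r) (a : ℂ) :
    mlPow (z * r) a = Complex.exp (a * (mlLog z + Real.log r)) := by
  have harg : mlArg (z * r) = mlArg z := by
    simp only [mlArg, Complex.arg_mul_real hr]
  rw [mlPow, harg, norm_mul, Complex.norm_real, Real.norm_of_nonneg hr.le,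
    Real.log_mul (norm_ne_zero_iff.2 hz) hr.ne', mlLog]
  congr 1
  push_cast
  ring

theorem sq_add_two_mul_cos_add_one_eq_mul (r φ : ℝ) : ((r ^ 2 + 2 * r * Real.cos φ + 1 : ℝ) : ℂ) =
    (r + Complex.exp (Complex.I * φ)) * (r + Complex.exp (-(Complex.I * φ))) := by
  have h1 : Complex.exp (Complex.I * φ) * Complex.exp (-(Complex.I * φ)) = 1 := by
    rw [← Complex.exp_add, add_neg_cancel, Complex.exp_zero]
  have h2 : (2 * Real.cos φ : ℂ) = Complex.exp (Complex.I * φ) + Complex.exp (-(Complex.I * φ)) := by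
    rw [Complex.ofReal_cos, Complex.two_cos, mul_comm Complex.I, neg_mul]
  push_cast at h2 ⊢
  linear_combination (r : ℂ) * h2 - h1

theorem sq_add_two_mul_cos_add_one_pos {r φ : ℝ} (hr : 0 < r) (hφ : |φ| < π) :
    0 < r ^ 2 + 2 * r * Real.cos φ + 1 := by
  have h : -1 < Real.cos φ := by
    rw [← Real.cos_abs, ← Real.cos_pi]
    exact Real.cos_lt_cos_of_nonneg_of_le_pi (abs_nonneg _) le_rfl hφ
  nlinarith [sq_nonneg (r - 1)]

/-- The integrand of the contour integral for `E_{ρ,μ}(z)` with the normalising factor, where the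
logarithmic coordinate is measured from the pole at `log z`. -/
noncomputable def mlShifted (ρ : ℝ) (μ z v : ℂ) : ℂ :=
  ρ / (2 * π * Complex.I) * mlIntegrand ρ μ z (mlLog z + v)

/-- The path is `w = -z r e^{iφ}`, that is `v = i(φ - π) + log r`, and `r⁻¹` is `dv/dr`. Thus `φ =
π` and `φ = -π` are the rays through the poles `v = 0` and `v = -2πi`. -/
theorem mlK'_eq (ρ : ℝ) (μ : ℂ) {z : ℂ} (hz : z ≠ 0) {r : ℝ} (hr : 0 < r) (φ : ℝ) :
    mlK' ρ μ r φ z =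
      mlShifted ρ μ z (((φ - π : ℝ) : ℂ) * Complex.I + Real.log r) * (r : ℂ)⁻¹ := by
  set v : ℂ := ((φ - π : ℝ) : ℂ) * Complex.I + Real.log r with hv
  have hr' : (r : ℂ) ≠ 0 := by exact_mod_cast hr.ne'
  have hp : Complex.exp (ρ * (mlLog z + v)) = mlPow (z * r) ρ * Complex.exp (-Complex.I * π * ρ) *
      (Real.cos (ρ * φ) + Real.sin (ρ * φ) * Complex.I) := by
    rw [mlPow_mul_ofReal hz hr, Complex.ofReal_cos, Complex.ofReal_sin, ← Complex.exp_mul_I,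
      ← Complex.exp_add, ← Complex.exp_add, hv]
    congr 1
    push_cast
    ring
  have hq : Complex.exp (ρ * (1 - μ) * (mlLog z + v)) = mlPow (z * r) (ρ * (1 - μ)) *
      Complex.exp (Complex.I * (ρ * (1 - μ) * φ - π * ρ * (1 - μ))) := by
    rw [mlPow_mul_ofReal hz hr, ← Complex.exp_add, hv]
    congr 1
    push_cast
    ring
  have he : Complex.exp (mlLog z + v) = -(z * (r * Complex.exp (Complex.I * φ))) := by
    rw [Complex.exp_add, exp_mlLog hz, hv, Complex.exp_add, ← Complex.ofReal_exp, Real.exp_log hr]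
    push_cast
    rw [sub_mul, Complex.exp_sub, Complex.exp_pi_mul_I, mul_comm (φ : ℂ)]
    ring
  have hfrac : (r + Complex.exp (Complex.I * φ)) / ((r ^ 2 + 2 * r * Real.cos φ + 1 : ℝ) : ℂ) =
      Complex.exp (mlLog z + v) / (Complex.exp (mlLog z + v) - z) * (r : ℂ)⁻¹ := by
    have h1 : Complex.exp (Complex.I * φ) * Complex.exp (-(Complex.I * φ)) = 1 := by
      rw [← Complex.exp_add, add_neg_cancel, Complex.exp_zero]
    have h0 := Complex.exp_ne_zero (Complex.I * φ)
    have h3 : -(z * (r * Complex.exp (Complex.I * φ))) - z =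
        -z * Complex.exp (Complex.I * φ) * (r + Complex.exp (-(Complex.I * φ))) := by
      linear_combination z * h1
    rw [sq_add_two_mul_cos_add_one_eq_mul, he, h3]
    -- At the pole itself (`r = 1`, `exp (iφ) = -1`) both quotients have denominator `0` and equal
    -- `0`, so the identity needs no exception.
    by_cases hN : (r + Complex.exp (-(Complex.I * φ)) : ℂ) = 0
    · rw [hN]; simp
    have hN' : (r + Complex.exp (Complex.I * φ) : ℂ) ≠ 0 := by
      intro h
      apply hN
      have := congrArg (starRingEnd ℂ) h
      simpa [← Complex.exp_conj] using this
    field_simp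
  rw [mlK', mlShifted, mlIntegrand, hq, hp, mul_add (mlPow _ _ * _), Complex.exp_add (_ * _)]
  have e1 : Complex.exp (Complex.I * (mlEta ρ μ r φ z - π * ρ * (1 - μ))) =
      Complex.exp (mlPow (z * r) ρ * Complex.exp (-Complex.I * π * ρ) *
        (Real.sin (ρ * φ) * Complex.I)) *
      Complex.exp (Complex.I * (ρ * (1 - μ) * φ - π * ρ * (1 - μ))) := by
    rw [← Complex.exp_add, mlEta]
    rw [show -Complex.I * ρ * π = -Complex.I * π * ρ by ring]
    congr 1
    ring
  rw [e1]
  linear_combination (ρ / (2 * π * Complex.I) *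
    Complex.exp (mlPow (z * r) ρ * Complex.exp (-Complex.I * π * ρ) * (Real.cos (ρ * φ) : ℂ)) *
    Complex.exp (mlPow (z * r) ρ * Complex.exp (-Complex.I * π * ρ) *
        (Real.sin (ρ * φ) * Complex.I)) * mlPow (z * r) (ρ * (1 - μ)) *
    Complex.exp (Complex.I * (ρ * (1 - μ) * φ - π * ρ * (1 - μ)))) * hfrac

theorem mlK_eq (ρ : ℝ) (μ z : ℂ) {r φ₁ φ₂ : ℝ} (hr : 0 < r) (h1 : |φ₁| < π) (h2 : |φ₂| < π) :
    mlK ρ μ r φ₁ φ₂ z = mlK' ρ μ r φ₂ z - mlK' ρ μ r φ₁ z := by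
  have hd1 : ((r ^ 2 + 2 * r * Real.cos φ₁ + 1 : ℝ) : ℂ) ≠ 0 := by
    exact_mod_cast (sq_add_two_mul_cos_add_one_pos hr h1).ne'
  have hd2 : ((r ^ 2 + 2 * r * Real.cos φ₂ + 1 : ℝ) : ℂ) ≠ 0 := by
    exact_mod_cast (sq_add_two_mul_cos_add_one_pos hr h2).ne'
  have e : ∀ φ : ℝ, Complex.exp (Complex.I * (mlEta ρ μ r φ z - π * ρ * (1 - μ))) =
      Complex.exp (Complex.I * mlEta ρ μ r φ z) * Complex.exp (-Complex.I * ρ * π * (1 - μ)) := by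
    intro φ
    rw [← Complex.exp_add]
    congr 1
    ring
  rw [mlK, mlA, mlA, mlK', mlK', e, e, show -Complex.I * π * ρ = -Complex.I * ρ * π by ring,
    Complex.ofReal_mul]
  generalize ((r ^ 2 + 2 * r * Real.cos φ₁ + 1 : ℝ) : ℂ) = d1 at *
  generalize ((r ^ 2 + 2 * r * Real.cos φ₂ + 1 : ℝ) : ℂ) = d2 at *
  field_simp

/-- `mlEta` is odd in the angle, so the sines combine the exponentials for `φ` and `-φ`. Both rays
share one denominator, hence no condition on `φ` is required. -/
theorem mlKSym_eq (ρ : ℝ) (μ z : ℂ) (r φ : ℝ) :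
    mlKSym ρ μ r φ z = mlK' ρ μ r φ z - mlK' ρ μ r (-φ) z := by
  have hη : mlEta ρ μ r (-φ) z = -mlEta ρ μ r φ z := by
    rw [mlEta, mlEta, mul_neg, Real.sin_neg]
    push_cast
    ring
  have e : ∀ w : ℂ, Complex.exp (Complex.I * (w - π * ρ * (1 - μ))) =
      Complex.exp (Complex.I * w) * Complex.exp (-Complex.I * π * (ρ * (1 - μ))) := by
    intro w
    rw [← Complex.exp_add]
    congr 1
    ring
  rw [mlKSym, mlK', mlK', hη, e, e, mul_neg ρ, Real.cos_neg, Real.cos_neg]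
  have s1 : ∀ w : ℂ, Complex.sin w =
      (Complex.exp (Complex.I * w) - Complex.exp (Complex.I * -w)) / (2 * Complex.I) := by
    intro w
    rw [Complex.sin, mul_comm Complex.I, mul_comm Complex.I, ← mul_div_mul_right _ _ Complex.I_ne_zero]
    congr 1
    linear_combination (Complex.exp (-w * Complex.I) - Complex.exp (w * Complex.I)) * Complex.I_mul_I
  rw [s1, s1, neg_add, mul_add, mul_add, Complex.exp_add, Complex.exp_add, Complex.ofReal_neg]
  have hpi : (π : ℂ) ≠ 0 := by exact_mod_cast Real.pi_ne_zero
  have hI := Complex.I_ne_zero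
  field_simp
  ring

theorem one_add_ofReal_mul_exp_re_pos {τ : ℝ} (h0 : 0 < τ) (h1 : τ < 1) (ψ : ℝ) :
    0 < (1 + τ * Complex.exp (ψ * Complex.I) : ℂ).re := by
  rw [Complex.add_re, Complex.re_ofReal_mul, Complex.exp_ofReal_mul_I_re, Complex.one_re]
  nlinarith [Real.neg_one_le_cos ψ]

theorem mlRad_eq (τ ψ : ℝ) : mlRad τ ψ = ‖(1 + τ * Complex.exp (ψ * Complex.I) : ℂ)‖ := by
  rw [mlRad, Complex.norm_eq_sqrt_sq_add_sq, Complex.add_re, Complex.add_im, Complex.re_ofReal_mul,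
    Complex.im_ofReal_mul, Complex.exp_ofReal_mul_I_re, Complex.exp_ofReal_mul_I_im, Complex.one_re,
    Complex.one_im]
  congr 1
  linear_combination (-τ ^ 2) * Real.sin_sq_add_cos_sq ψ

/-- For `τ < 1` the point `1 + τ e^{iψ}` lies in the right half-plane, where the arctangent of the
slope is the argument. -/
theorem mlAng_eq {τ : ℝ} (h0 : 0 < τ) (h1 : τ < 1) (ψ : ℝ) (k : ℤ) :
    mlAng τ ψ k = (1 + τ * Complex.exp (ψ * Complex.I) : ℂ).arg + k * π := by
  have h := one_add_ofReal_mul_exp_re_pos h0 h1 ψ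
  have harg := Complex.abs_arg_lt_pi_div_two_iff.2 (Or.inl h)
  rw [abs_lt] at harg
  rw [mlAng, ← Real.arctan_tan harg.1 harg.2, Complex.tan_arg, Complex.add_re, Complex.add_im,
    Complex.re_ofReal_mul, Complex.im_ofReal_mul, Complex.exp_ofReal_mul_I_re,
    Complex.exp_ofReal_mul_I_im, Complex.one_re, Complex.one_im, zero_add, add_comm (1 : ℝ)]

/-- The path is the circle `w = z (1 + τ e^{iψ})`, lifted to the sheet `k`; evenness of `k` makes
`exp (kπi) = 1`. With `u = 1 + τ e^{iψ}` the denominator of `mlP'` is `‖u - 1‖² = τ²`. -/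
theorem mlP'_eq (ρ : ℝ) (μ : ℂ) {z : ℂ} (hz : z ≠ 0) {τ : ℝ} (h0 : 0 < τ) (h1 : τ < 1) (ψ : ℝ)
    {k : ℤ} (hk : Even k) :
    mlP' ρ μ τ ψ k z =
      mlShifted ρ μ z (Complex.log (1 + τ * Complex.exp (ψ * Complex.I)) + k * π * Complex.I) *
        (τ * Complex.exp (ψ * Complex.I) * Complex.I / (1 + τ * Complex.exp (ψ * Complex.I))) := by
  set u : ℂ := 1 + τ * Complex.exp (ψ * Complex.I) with hu
  have hre : 0 < u.re := one_add_ofReal_mul_exp_re_pos h0 h1 ψ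
  have hu0 : u ≠ 0 := fun h => by rw [h] at hre; simp at hre
  have hR := mlRad_eq τ ψ
  rw [← hu] at hR
  have hR0 : 0 < mlRad τ ψ := by rw [hR]; exact norm_pos_iff.2 hu0
  have hA := mlAng_eq h0 h1 ψ k
  rw [← hu] at hA
  set v : ℂ := Complex.log u + k * π * Complex.I with hv
  have hv' : v = Real.log (mlRad τ ψ) + mlAng τ ψ k * Complex.I := by
    rw [hv, hR, hA, Complex.log]
    push_cast
    ring
  have hk1 : Complex.exp (k * π * Complex.I) = 1 := by
    obtain ⟨m, rfl⟩ := hk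
    rw [Complex.exp_eq_one_iff]
    exact ⟨m, by push_cast; ring⟩
  have hev : Complex.exp v = u := by
    rw [hv, Complex.exp_add, Complex.exp_log hu0, hk1, mul_one]
  have hpolar : (mlRad τ ψ : ℂ) * Complex.exp (mlAng τ ψ k * Complex.I) = u := by
    rw [← exp_log_add_mul_I hR0, ← hv', hev]
  have hpolar' : (mlRad τ ψ : ℂ) * Complex.exp (-Complex.I * mlAng τ ψ k) =
      1 + τ * Complex.exp (-(ψ * Complex.I)) := by
    have := congrArg (starRingEnd ℂ) hpolar
    rw [hu] at this
    simp only [map_mul, map_add, map_one, Complex.conj_ofReal, ← Complex.exp_conj,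
      Complex.conj_I] at this
    rw [show -Complex.I * mlAng τ ψ k = mlAng τ ψ k * -Complex.I by ring, this, mul_neg]
  have hden : ((mlRad τ ψ ^ 2 - 2 * mlRad τ ψ * Real.cos (mlAng τ ψ k) + 1 : ℝ) : ℂ) =
      (τ : ℂ) ^ 2 := by
    have h2 : (2 * Real.cos (mlAng τ ψ k) : ℂ) = Complex.exp (mlAng τ ψ k * Complex.I) +
        Complex.exp (-Complex.I * mlAng τ ψ k) := by
      rw [Complex.ofReal_cos, Complex.two_cos]
      congr 2
      ring
    have h3 : Complex.exp (mlAng τ ψ k * Complex.I) *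
        Complex.exp (-Complex.I * mlAng τ ψ k) = 1 := by
      rw [← Complex.exp_add, ← Complex.exp_zero]
      congr 1
      ring
    have h4 : Complex.exp (ψ * Complex.I) * Complex.exp (-(ψ * Complex.I)) = 1 := by
      rw [← Complex.exp_add, add_neg_cancel, Complex.exp_zero]
    have h5 : ((mlRad τ ψ : ℂ) * Complex.exp (mlAng τ ψ k * Complex.I) - 1) *
        ((mlRad τ ψ : ℂ) * Complex.exp (-Complex.I * mlAng τ ψ k) - 1) = (τ : ℂ) ^ 2 := by
      rw [hpolar, hpolar', hu]
      linear_combination (τ : ℂ) ^ 2 * h4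
    rw [← h5]
    push_cast at h2 ⊢
    linear_combination (-(mlRad τ ψ : ℂ)) * h2 - (mlRad τ ψ : ℂ) ^ 2 * h3
  have hp : Complex.exp (ρ * (mlLog z + v)) = mlPow (z * mlRad τ ψ) ρ *
      (Real.cos (ρ * mlAng τ ψ k) + Real.sin (ρ * mlAng τ ψ k) * Complex.I) := by
    rw [mlPow_mul_ofReal hz hR0, Complex.ofReal_cos, Complex.ofReal_sin, ← Complex.exp_mul_I,
      ← Complex.exp_add, hv']
    congr 1
    push_cast
    ring
  have hq : Complex.exp (ρ * (1 - μ) * (mlLog z + v)) = mlPow (z * mlRad τ ψ) (ρ * (1 - μ)) *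
      Complex.exp (Complex.I * (ρ * (1 - μ) * mlAng τ ψ k)) := by
    rw [mlPow_mul_ofReal hz hR0, ← Complex.exp_add, hv']
    congr 1
    ring
  have hfrac : Complex.exp (mlLog z + v) / (Complex.exp (mlLog z + v) - z) *
      (τ * Complex.exp (ψ * Complex.I) * Complex.I / u) = Complex.I := by
    have hτ : (τ : ℂ) ≠ 0 := by exact_mod_cast h0.ne'
    have hE := Complex.exp_ne_zero (ψ * Complex.I)
    have : z * u - z = z * (τ * Complex.exp (ψ * Complex.I)) := by rw [hu]; ring
    rw [Complex.exp_add, exp_mlLog hz, hev, this]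
    field_simp
  have hχ : Complex.exp (Complex.I * (mlChi' ρ μ τ ψ k z + ψ)) =
      Complex.exp (mlPow (z * mlRad τ ψ) ρ * (Real.sin (ρ * mlAng τ ψ k) * Complex.I)) *
      Complex.exp (Complex.I * (ρ * (1 - μ) * mlAng τ ψ k)) * Complex.exp (ψ * Complex.I) := by
    rw [← Complex.exp_add, ← Complex.exp_add, mlChi']
    congr 1
    ring
  have hτ : (τ : ℂ) ≠ 0 := by exact_mod_cast h0.ne'
  have hpi : (π : ℂ) ≠ 0 := by exact_mod_cast Real.pi_ne_zero
  have h4 : Complex.exp (ψ * Complex.I) * Complex.exp (-(ψ * Complex.I)) = 1 := by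
    rw [← Complex.exp_add, add_neg_cancel, Complex.exp_zero]
  rw [mlP', mlShifted, mlIntegrand, hden, hpolar', hχ, hp, hq, mul_add (mlPow _ _), Complex.exp_add]
  generalize Complex.exp (mlPow (z * mlRad τ ψ) ρ * (Real.cos (ρ * mlAng τ ψ k) : ℂ)) = A
  generalize Complex.exp (mlPow (z * mlRad τ ψ) ρ * (Real.sin (ρ * mlAng τ ψ k) * Complex.I)) = B
  generalize mlPow (z * mlRad τ ψ) (ρ * (1 - μ)) = Q
  generalize Complex.exp (Complex.I * (ρ * (1 - μ) * mlAng τ ψ k)) = R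
  have e1 : ρ * τ / (2 * π) * (A / (τ : ℂ) ^ 2) * Q * (B * R * Complex.exp (ψ * Complex.I)) *
      (1 + τ * Complex.exp (-(ψ * Complex.I)) - 1) = ρ / (2 * π) * (A * B * (Q * R)) := by
    field_simp
    linear_combination (ρ * τ * A * Q * B * R) * h4
  rw [e1]
  calc ρ / (2 * π) * (A * B * (Q * R)) =
        ρ / (2 * π * Complex.I) * (A * B * (Q * R)) * Complex.I := by
          have := Complex.I_ne_zero
          field_simp
    _ = _ := by linear_combination (-(ρ / (2 * π * Complex.I) * (A * B * (Q * R)))) * hfrac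

/-! ### The region free of poles, and integrals along rays and arcs. -/

/-- The plane cut along two opposite vertical rays that contain all the poles of
`1 / (exp v - 1)`. -/
def slitRegion : Set ℂ := {v | v.re ≠ 0 ∨ (-(2 * π) < v.im ∧ v.im < 0)}

theorem isOpen_slitRegion : IsOpen slitRegion := by
  refine IsOpen.union ?_ (IsOpen.inter ?_ ?_)
  · exact isOpen_ne_fun Complex.continuous_re continuous_const
  · exact isOpen_lt continuous_const Complex.continuous_im
  · exact isOpen_lt Complex.continuous_im continuous_const

/-- The centre is the midpoint of the gap. Moving towards it only scales the real part by a positive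
factor, so a point off the imaginary axis stays off it until the centre is reached, while the strip
between the poles is convex. -/
theorem starConvex_slitRegion : StarConvex ℝ (-(π * Complex.I)) slitRegion := by
  intro v hv a b ha hb hab
  have hπ := Real.pi_pos
  rcases hb.eq_or_lt with rfl | hb
  · right
    have ha1 : a = 1 := by linarith
    subst ha1
    simp only [Complex.real_smul]
    constructor <;> simp <;> linarith
  · rcases hv with hv | hv
    · left
      simp [hb.ne', hv]
    · right
      have h1 := mul_lt_mul_of_pos_left hv.1 hb
      have h2 := mul_lt_mul_of_pos_left hv.2 hb
      have h3 := mul_nonneg ha hπ.le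
      have h4 : a * π = π - b * π := by rw [← sub_eq_of_eq_add hab.symm]; ring
      constructor <;> simp <;> nlinarith

theorem exp_ne_one_of_mem_slitRegion {v : ℂ} (hv : v ∈ slitRegion) : Complex.exp v ≠ 1 := by
  intro h
  obtain ⟨n, rfl⟩ := Complex.exp_eq_one_iff.1 h
  rcases hv with hv | ⟨h1, h2⟩
  · simp at hv
  · have hπ := Real.two_pi_pos
    have him : ((n : ℂ) * (2 * π * Complex.I)).im = n * (2 * π) := by simp
    rw [him] at h1 h2
    have hn1 : (n : ℝ) < 0 := by by_contra! h; nlinarith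
    have hn2 : (-1 : ℝ) < n := by by_contra! h; nlinarith
    have hn1' : n < 0 := by exact_mod_cast hn1
    have hn2' : -1 < n := by exact_mod_cast hn2
    omega

theorem differentiableOn_mlShifted (ρ : ℝ) (μ : ℂ) {z : ℂ} (hz : z ≠ 0) :
    DifferentiableOn ℂ (mlShifted ρ μ z) slitRegion := by
  have h : ∀ v ∈ slitRegion, Complex.exp (mlLog z + v) - z ≠ 0 := by
    intro v hv
    rw [Complex.exp_add, exp_mlLog hz]
    intro h
    have h1 : z * (Complex.exp v - 1) = 0 := by linear_combination h
    rcases mul_eq_zero.1 h1 with h2 | h2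
    · exact hz h2
    · exact exp_ne_one_of_mem_slitRegion hv (sub_eq_zero.1 h2)
  unfold mlShifted mlIntegrand
  refine DifferentiableOn.const_mul (DifferentiableOn.mul (by fun_prop) ?_) _
  exact DifferentiableOn.div (by fun_prop) (by fun_prop) h

theorem hasDerivAt_ray (φ : ℝ) {r : ℝ} (hr : 0 < r) :
    HasDerivAt (fun t : ℝ => ((φ - π : ℝ) : ℂ) * Complex.I + (Real.log t : ℂ)) (r : ℂ)⁻¹ r :=
  hasDerivAt_log_add _ hr

theorem ray_mem_slitRegion {φ r : ℝ} (hr : 0 < r) (h : r ≠ 1 ∨ |φ| < π) :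
    ((φ - π : ℝ) : ℂ) * Complex.I + (Real.log r : ℂ) ∈ slitRegion := by
  rcases h with h | h
  · left
    simp only [Complex.add_re, Complex.re_ofReal_mul, Complex.I_re, mul_zero, zero_add,
      Complex.ofReal_re]
    exact Real.log_ne_zero_of_pos_of_ne_one hr h
  · right
    rw [abs_lt] at h
    simp only [Complex.add_im, Complex.im_ofReal_mul, Complex.I_im, mul_one, Complex.ofReal_im,
      add_zero]
    constructor <;> linarith [h.1, h.2]

theorem integral_mlK'_eq_sub {ρ : ℝ} {μ z : ℂ} (hz : z ≠ 0) {Φ : ℂ → ℂ}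
    (hΦ : ∀ v ∈ slitRegion, HasDerivAt Φ (mlShifted ρ μ z v) v) {φ a b : ℝ} (ha : 0 < a)
    (hab : a ≤ b) (h : ∀ r ∈ Set.Icc a b, r ≠ 1 ∨ |φ| < π) :
    ∫ r in a..b, mlK' ρ μ r φ z =
      Φ (((φ - π : ℝ) : ℂ) * Complex.I + (Real.log b : ℂ)) -
        Φ (((φ - π : ℝ) : ℂ) * Complex.I + (Real.log a : ℂ)) := by
  have hIcc := Set.uIcc_of_le hab
  have hpos : ∀ r ∈ Set.uIcc a b, 0 < r := fun r hr => by
    rw [hIcc] at hr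
    exact ha.trans_le hr.1
  have hmem : ∀ r ∈ Set.uIcc a b,
      ((φ - π : ℝ) : ℂ) * Complex.I + (Real.log r : ℂ) ∈ slitRegion := fun r hr =>
    ray_mem_slitRegion (hpos r hr) (h r (hIcc ▸ hr))
  rw [← integral_comp_mul_deriv_of_primitive (F := Φ) (f := mlShifted ρ μ z)
    (γ := fun r : ℝ => ((φ - π : ℝ) : ℂ) * Complex.I + (Real.log r : ℂ))
    (fun r hr => hasDerivAt_ray φ (hpos r hr)) (fun r hr => hΦ _ (hmem r hr))]
  · exact intervalIntegral.integral_congr fun r hr => mlK'_eq ρ μ hz (hpos r hr) φ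
  · refine ContinuousOn.intervalIntegrable (ContinuousOn.mul ?_ ?_)
    · refine (differentiableOn_mlShifted ρ μ hz).continuousOn.comp ?_ hmem
      exact fun r hr => (hasDerivAt_ray φ (hpos r hr)).continuousAt.continuousWithinAt
    · refine ContinuousOn.inv₀ (by fun_prop) fun r hr => ?_
      exact_mod_cast (hpos r hr).ne'

/-- At infinity the negative cosine gives exponential decay; at the origin the kernel is of order `r
^ (ρ * (1 - Re μ))`, with exponent above `-1`. The set `S` and the distance `m` from the pole cover
both full rays and rays with a neighbourhood of the pole removed. -/
theorem integrableOn_mlK' {ρ : ℝ} (hρ : 0 < ρ) {μ z : ℂ} (hμ : μ.re < 1 + 1 / ρ) (hz : z ≠ 0)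
    {φ m : ℝ} (hcos : Real.cos (ρ * (mlArg z + (φ - π))) < 0) (hm : 0 < m) {S : Set ℝ}
    (hS : MeasurableSet S) (hS0 : S ⊆ Set.Ioi 0)
    (hSm : ∀ r ∈ S, m ≤ ‖(r * Complex.exp (φ * Complex.I) + 1 : ℂ)‖) :
    IntegrableOn (fun r : ℝ => mlK' ρ μ r φ z) S := by
  have hz0 : 0 < ‖z‖ := norm_pos_iff.2 hz
  have hexp : -1 < ρ * (1 - μ.re) := by
    have h1 := mul_lt_mul_of_pos_left hμ hρ
    rw [mul_add, mul_one_div_cancel hρ.ne'] at h1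
    linarith
  set θ : ℝ := mlArg z + (φ - π) with hθ
  set c : ℝ := -Real.cos (ρ * θ) with hc
  have hc0 : 0 < c := neg_pos.2 hcos
  have hshift : ∀ r : ℝ, 0 < r → mlLog z + (((φ - π : ℝ) : ℂ) * Complex.I + Real.log r) =
      (Real.log (‖z‖ * r) : ℂ) + θ * Complex.I := by
    intro r hr
    rw [Real.log_mul hz0.ne' hr.ne', mlLog, hθ]
    push_cast
    ring
  have hbase := (integrableOn_rpow_mul_exp_neg_mul_rpow (b := c * ‖z‖ ^ ρ) hexp hρ
    (by positivity)).mono_set hS0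
  have hbig : IntegrableOn (fun r : ℝ => ‖(ρ / (2 * π * Complex.I) : ℂ)‖ *
      (‖z‖ ^ (ρ * (1 - μ.re)) * Real.exp (ρ * |μ.im| * |θ|) / m) *
      (r ^ (ρ * (1 - μ.re)) * Real.exp (-(c * ‖z‖ ^ ρ) * r ^ ρ))) S := hbase.const_mul _
  have hmeas : Measurable fun r : ℝ =>
      mlShifted ρ μ z (((φ - π : ℝ) : ℂ) * Complex.I + Real.log r) * (r : ℂ)⁻¹ := by
    unfold mlShifted mlIntegrand
    fun_prop
  refine hbig.mono' (hmeas.aestronglyMeasurable.congr ?_) ?_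
  · filter_upwards [ae_restrict_mem hS] with r hr using (mlK'_eq ρ μ hz (hS0 hr) φ).symm
  · filter_upwards [ae_restrict_mem hS] with r hr
    have hr0 : 0 < r := hS0 hr
    rw [mlK'_eq ρ μ hz hr0, mlShifted, norm_mul, norm_mul, mul_assoc ‖_‖, mul_assoc ‖_‖, hshift r hr0]
    refine mul_le_mul_of_nonneg_left ?_ (norm_nonneg _)
    have hb : 0 < ‖z‖ * r := by positivity
    have h1 := norm_mlIntegrand_le hρ μ z hb (c := -c) (by rw [hc, neg_neg]) (le_refl |θ|)
    have h2 : ‖Complex.exp ((Real.log (‖z‖ * r) : ℂ) + θ * Complex.I) - z‖ =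
        ‖z‖ * ‖(r * Complex.exp (φ * Complex.I) + 1 : ℂ)‖ := by
      rw [← hshift r hr0, Complex.exp_add, exp_mlLog hz, Complex.exp_add, ← Complex.ofReal_exp,
        Real.exp_log hr0]
      push_cast
      rw [sub_mul, Complex.exp_sub, Complex.exp_pi_mul_I, ← norm_mul, ← norm_neg]
      congr 1
      ring
    rw [h2] at h1
    rw [norm_inv, Complex.norm_real, Real.norm_of_nonneg hr0.le]
    have h3 : ‖z‖ * r / (‖z‖ * ‖(r * Complex.exp (φ * Complex.I) + 1 : ℂ)‖) ≤ r / m := by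
      rw [mul_div_mul_left _ _ hz0.ne']
      have := hSm r hr
      gcongr
    calc _ ≤ (Real.exp (-c * (‖z‖ * r) ^ ρ) * (‖z‖ * r) ^ (ρ * (1 - μ.re)) *
          Real.exp (ρ * |μ.im| * |θ|) * (r / m)) * r⁻¹ := by
          gcongr
          exact h1.trans (by gcongr)
      _ = _ := by
          rw [Real.mul_rpow hz0.le hr0.le, Real.mul_rpow hz0.le hr0.le]
          field_simp

theorem abs_sin_le_norm_mul_exp_add_one (r φ : ℝ) :
    |Real.sin φ| ≤ ‖(r * Complex.exp (φ * Complex.I) + 1 : ℂ)‖ := by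
  have h : ‖(r * Complex.exp (φ * Complex.I) + 1 : ℂ)‖ =
      ‖(r + Complex.exp (-φ * Complex.I) : ℂ)‖ := by
    have : (r * Complex.exp (φ * Complex.I) + 1 : ℂ) =
        Complex.exp (φ * Complex.I) * (r + Complex.exp (-φ * Complex.I)) := by
      rw [mul_add, ← Complex.exp_add, neg_mul, add_neg_cancel, Complex.exp_zero]
      ring
    rw [this, norm_mul, Complex.norm_exp_ofReal_mul_I, one_mul]
  rw [h]
  refine le_trans (le_of_eq ?_) (Complex.abs_im_le_norm _)
  rw [Complex.add_im, Complex.ofReal_im, zero_add, ← Complex.ofReal_neg,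
    Complex.exp_ofReal_mul_I_im, Real.sin_neg, abs_neg]

theorem integrableOn_mlK'_of_abs_lt_pi {ρ : ℝ} (hρ : 0 < ρ) {μ z : ℂ} (hμ : μ.re < 1 + 1 / ρ)
    (hz : z ≠ 0) {φ : ℝ} (hcos : Real.cos (ρ * (mlArg z + (φ - π))) < 0) (hφ0 : φ ≠ 0)
    (hφ : |φ| < π) : IntegrableOn (fun r : ℝ => mlK' ρ μ r φ z) (Set.Ioi 0) := by
  refine integrableOn_mlK' hρ hμ hz hcos (m := |Real.sin φ|) ?_ measurableSet_Ioi subset_rfl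
    fun r _ => abs_sin_le_norm_mul_exp_add_one r φ
  rw [abs_lt] at hφ
  rw [abs_pos]
  intro h
  exact hφ0 ((Real.sin_eq_zero_iff_of_lt_of_lt hφ.1 hφ.2).1 h)

theorem integrableOn_mlK'_of_exp_eq {ρ : ℝ} (hρ : 0 < ρ) {μ z : ℂ} (hμ : μ.re < 1 + 1 / ρ)
    (hz : z ≠ 0) {φ : ℝ} (hcos : Real.cos (ρ * (mlArg z + (φ - π))) < 0)
    (hφ : Complex.exp (φ * Complex.I) = -1) {ε : ℝ} (hε : 0 < ε) {S : Set ℝ}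
    (hS : MeasurableSet S) (hS0 : S ⊆ Set.Ioi 0) (hSε : ∀ r ∈ S, ε ≤ |1 - r|) :
    IntegrableOn (fun r : ℝ => mlK' ρ μ r φ z) S := by
  refine integrableOn_mlK' hρ hμ hz hcos hε hS hS0 fun r hr => (hSε r hr).trans (le_of_eq ?_)
  rw [hφ, show (r * -1 + 1 : ℂ) = ((1 - r : ℝ) : ℂ) by push_cast; ring, Complex.norm_real,
    Real.norm_eq_abs]

theorem tendsto_integral_inv_left {f : ℝ → ℂ} {c : ℝ} (hc : 0 < c)
    (hf : IntervalIntegrable f volume 0 c) :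
    Filter.Tendsto (fun b : ℝ => ∫ r in b⁻¹..c, f r) Filter.atTop (nhds (∫ r in (0 : ℝ)..c, f r)) := by
  have h1 := intervalIntegral.continuousOn_primitive_interval_left (f := f) (a := 0) (b := c)
    (μ := volume) (by
      rw [Set.uIcc_of_le hc.le, integrableOn_Icc_iff_integrableOn_Ioc,
        ← intervalIntegrable_iff_integrableOn_Ioc_of_le hc.le]
      exact hf)
  rw [Set.uIcc_of_le hc.le] at h1
  refine (h1 0 (Set.left_mem_Icc.2 hc.le)).tendsto.comp ?_
  refine tendsto_nhdsWithin_iff.2 ⟨tendsto_inv_atTop_zero, ?_⟩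
  filter_upwards [Filter.eventually_ge_atTop c⁻¹, Filter.eventually_gt_atTop 0] with b hb hb0
  exact ⟨(inv_pos.2 hb0).le, inv_le_of_inv_le₀ hc hb⟩

/-- For `|φ| < π` the whole line passes through the gap, so the primitive can be used across `r =
1`. -/
theorem tendsto_primitive_sub_straight {ρ : ℝ} {μ z : ℂ} (hz : z ≠ 0) {Φ : ℂ → ℂ}
    (hΦ : ∀ v ∈ slitRegion, HasDerivAt Φ (mlShifted ρ μ z v) v) {φ : ℝ} (hφ : |φ| < π)
    (hint : IntegrableOn (fun r : ℝ => mlK' ρ μ r φ z) (Set.Ioi 0)) :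
    Filter.Tendsto (fun b : ℝ => Φ (((φ - π : ℝ) : ℂ) * Complex.I + (Real.log b : ℂ)) -
      Φ (((φ - π : ℝ) : ℂ) * Complex.I + (Real.log b⁻¹ : ℂ))) Filter.atTop
      (nhds (∫ r in Set.Ioi (0 : ℝ), mlK' ρ μ r φ z)) := by
  have hI : IntervalIntegrable (fun r : ℝ => mlK' ρ μ r φ z) volume 0 1 := by
    rw [intervalIntegrable_iff_integrableOn_Ioc_of_le zero_le_one]
    exact hint.mono_set Set.Ioc_subset_Ioi_self
  have hI1 := hint.mono_set (Set.Ioi_subset_Ioi zero_le_one)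
  have h := (tendsto_integral_inv_left one_pos hI).add
    (intervalIntegral_tendsto_integral_Ioi 1 hI1 Filter.tendsto_id)
  rw [intervalIntegral.integral_interval_add_Ioi hint hI1] at h
  refine h.congr' ?_
  filter_upwards [Filter.eventually_ge_atTop 1] with b hb
  have hb0 : 0 < b := by linarith
  have hb1 : b⁻¹ ≤ 1 := inv_le_one_of_one_le₀ hb
  simp only [id]
  rw [integral_mlK'_eq_sub hz hΦ (inv_pos.2 hb0) hb1 fun _ _ => Or.inr hφ,
    integral_mlK'_eq_sub hz hΦ one_pos hb fun _ _ => Or.inr hφ]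
  ring

theorem hasDerivAt_log_one_add_mul_exp {τ : ℝ} (h0 : 0 < τ) (h1 : τ < 1) (c : ℂ) (ψ : ℝ) :
    HasDerivAt (fun t : ℝ => Complex.log (1 + τ * Complex.exp (t * Complex.I)) + c)
      (τ * Complex.exp (ψ * Complex.I) * Complex.I / (1 + τ * Complex.exp (ψ * Complex.I))) ψ := by
  have ht : HasDerivAt (fun t : ℝ => (t : ℂ)) 1 ψ := Complex.ofRealCLM.hasDerivAt
  have h2 : HasDerivAt (fun t : ℝ => (1 + τ * Complex.exp (t * Complex.I) : ℂ))
      (τ * Complex.exp (ψ * Complex.I) * Complex.I) ψ := by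
    refine (((ht.mul_const Complex.I).cexp.const_mul (τ : ℂ)).const_add 1).congr_deriv ?_
    ring
  exact (h2.clog_real (Or.inl (one_add_ofReal_mul_exp_re_pos h0 h1 ψ))).add_const c

/-- Only points with `‖u‖ = 1`, `u = 1 + τ e^{iψ}`, could fall on a slit. There `arg u ≠ 0`, since
otherwise `u = 1`, and the sign of `sin ψ` puts the point strictly below the pole `0` or strictly
above the pole `-2πi`. -/
theorem arc_mem_slitRegion {τ : ℝ} (h0 : 0 < τ) (h1 : τ < 1) {ψ : ℝ} {k : ℤ}
    (hk : k = 0 ∧ Real.sin ψ ≤ 0 ∨ k = -2 ∧ 0 ≤ Real.sin ψ) :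
    Complex.log (1 + τ * Complex.exp (ψ * Complex.I)) + k * π * Complex.I ∈ slitRegion := by
  set u : ℂ := 1 + τ * Complex.exp (ψ * Complex.I) with hu
  have hre : 0 < u.re := one_add_ofReal_mul_exp_re_pos h0 h1 ψ
  have hu0 : u ≠ 0 := fun h => by rw [h] at hre; simp at hre
  have him : u.im = τ * Real.sin ψ := by
    rw [hu, Complex.add_im, Complex.im_ofReal_mul, Complex.exp_ofReal_mul_I_im, Complex.one_im,
      zero_add]
  have harg := Complex.abs_arg_lt_pi_div_two_iff.2 (Or.inl hre)
  rw [abs_lt] at harg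
  have hπ := Real.pi_pos
  have hkre : (Complex.log u + k * π * Complex.I).re = (Complex.log u).re := by simp
  have hkim : (Complex.log u + k * π * Complex.I).im = u.arg + k * π := by simp [Complex.log_im]
  by_cases hl : (Complex.log u).re = 0
  · right
    have hne : u.arg ≠ 0 := by
      intro h
      have hlog : Complex.log u = 0 := by
        rw [← Complex.re_add_im (Complex.log u), hl, Complex.log_im, h]; simp
      have hu1 : u = 1 := by rw [← Complex.exp_log hu0, hlog, Complex.exp_zero]
      have h2 : (τ : ℂ) * Complex.exp (ψ * Complex.I) = 0 := by
        rw [hu] at hu1; linear_combination hu1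
      rcases mul_eq_zero.1 h2 with h3 | h3
      · exact h0.ne' (by exact_mod_cast h3)
      · exact Complex.exp_ne_zero _ h3
    rw [hkim]
    rcases hk with ⟨rfl, hs⟩ | ⟨rfl, hs⟩
    · have h2 : u.arg ≤ 0 := by
        rcases hs.lt_or_eq with hs | hs
        · exact (Complex.arg_neg_iff.2 (by rw [him]; nlinarith)).le
        · refine absurd ?_ hne
          exact Complex.arg_eq_zero_iff.2 ⟨hre.le, by rw [him, hs, mul_zero]⟩
      have := lt_of_le_of_ne h2 hne
      push_cast
      constructor <;> linarith [harg.1]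
    · have h2 : 0 ≤ u.arg := Complex.arg_nonneg_iff.2 (by rw [him]; positivity)
      have := lt_of_le_of_ne h2 hne.symm
      push_cast
      constructor <;> linarith [harg.2]
  · left
    rw [hkre]
    exact hl

theorem continuousOn_mlP' (ρ : ℝ) (μ : ℂ) {z : ℂ} (hz : z ≠ 0) {τ : ℝ} (h0 : 0 < τ) (h1 : τ < 1)
    {k : ℤ} {S : Set ℝ}
    (hk : ∀ ψ ∈ S, k = 0 ∧ Real.sin ψ ≤ 0 ∨ k = -2 ∧ 0 ≤ Real.sin ψ) (hkeven : Even k) :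
    ContinuousOn (fun ψ => mlP' ρ μ τ ψ k z) S := by
  have hne : ∀ ψ : ℝ, (1 + τ * Complex.exp (ψ * Complex.I) : ℂ) ≠ 0 := fun ψ h => by
    have := one_add_ofReal_mul_exp_re_pos h0 h1 ψ
    rw [h] at this
    simp at this
  refine ContinuousOn.congr (ContinuousOn.mul ?_ ?_) fun ψ _ => mlP'_eq ρ μ hz h0 h1 ψ hkeven
  · refine (differentiableOn_mlShifted ρ μ hz).continuousOn.comp ?_ fun ψ hψ =>
      arc_mem_slitRegion h0 h1 (hk ψ hψ)
    exact fun ψ _ => (hasDerivAt_log_one_add_mul_exp h0 h1 _ ψ).continuousAt.continuousWithinAt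
  · exact Continuous.continuousOn (Continuous.div (by fun_prop) (by fun_prop) hne)

theorem integral_mlP'_eq_sub {ρ : ℝ} {μ z : ℂ} (hz : z ≠ 0) {Φ : ℂ → ℂ}
    (hΦ : ∀ v ∈ slitRegion, HasDerivAt Φ (mlShifted ρ μ z v) v) {τ : ℝ} (h0 : 0 < τ) (h1 : τ < 1)
    {k : ℤ} {α β : ℝ} (hkeven : Even k)
    (hk : ∀ ψ ∈ Set.uIcc α β, k = 0 ∧ Real.sin ψ ≤ 0 ∨ k = -2 ∧ 0 ≤ Real.sin ψ) :
    ∫ ψ in α..β, mlP' ρ μ τ ψ k z =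
      Φ (Complex.log (1 + τ * Complex.exp (β * Complex.I)) + k * π * Complex.I) -
        Φ (Complex.log (1 + τ * Complex.exp (α * Complex.I)) + k * π * Complex.I) := by
  have hcongr := fun ψ => mlP'_eq ρ μ hz h0 h1 ψ hkeven
  rw [← integral_comp_mul_deriv_of_primitive (F := Φ) (f := mlShifted ρ μ z)
    (γ := fun ψ : ℝ => Complex.log (1 + τ * Complex.exp (ψ * Complex.I)) + k * π * Complex.I)
    (fun ψ _ => hasDerivAt_log_one_add_mul_exp h0 h1 _ ψ)
    (fun ψ hψ => hΦ _ (arc_mem_slitRegion h0 h1 (hk ψ hψ)))]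
  · exact intervalIntegral.integral_congr fun ψ _ => hcongr ψ
  · have := (continuousOn_mlP' ρ μ hz h0 h1 hk hkeven).intervalIntegrable (μ := volume)
    simpa only [hcongr] using this

/-- The line through the pole, where the segment around the pole is replaced by a path whose
integral is `J`. -/
theorem tendsto_primitive_sub_dented {ρ : ℝ} {μ z : ℂ} (hz : z ≠ 0) {Φ : ℂ → ℂ}
    (hΦ : ∀ v ∈ slitRegion, HasDerivAt Φ (mlShifted ρ μ z v) v) {φ ε : ℝ} (h0 : 0 < ε)
    (h1 : ε < 1) {J : ℂ}
    (hint0 : IntervalIntegrable (fun r : ℝ => mlK' ρ μ r φ z) volume 0 (1 - ε))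
    (hint1 : IntegrableOn (fun r : ℝ => mlK' ρ μ r φ z) (Set.Ioi (1 + ε)))
    (hJ : J = Φ (((φ - π : ℝ) : ℂ) * Complex.I + (Real.log (1 + ε) : ℂ)) -
      Φ (((φ - π : ℝ) : ℂ) * Complex.I + (Real.log (1 - ε) : ℂ))) :
    Filter.Tendsto (fun b : ℝ => Φ (((φ - π : ℝ) : ℂ) * Complex.I + (Real.log b : ℂ)) -
      Φ (((φ - π : ℝ) : ℂ) * Complex.I + (Real.log b⁻¹ : ℂ))) Filter.atTop
      (nhds ((∫ r in (0 : ℝ)..(1 - ε), mlK' ρ μ r φ z) +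
        (∫ r in Set.Ioi (1 + ε), mlK' ρ μ r φ z) + J)) := by
  have hε : 0 < 1 - ε := by linarith
  have h := ((tendsto_integral_inv_left hε hint0).add
    (intervalIntegral_tendsto_integral_Ioi _ hint1 Filter.tendsto_id)).add_const J
  refine h.congr' ?_
  filter_upwards [Filter.eventually_ge_atTop (1 + ε), Filter.eventually_ge_atTop (1 - ε)⁻¹]
    with b hb hb'
  have hb0 : 0 < b := by linarith
  have hb1 : b⁻¹ ≤ 1 - ε := inv_le_of_inv_le₀ hε hb'
  simp only [id]
  rw [integral_mlK'_eq_sub hz hΦ (inv_pos.2 hb0) hb1 fun r hr => Or.inl (by linarith [hr.2]),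
    integral_mlK'_eq_sub hz hΦ (by linarith) hb fun r hr => Or.inl (by linarith [hr.1]), hJ]
  ring

/-! ### Closing the contour. -/

theorem primitive_sub_eq_integral {ρ : ℝ} {μ z : ℂ} (hz : z ≠ 0) {Φ : ℂ → ℂ}
    (hΦ : ∀ v ∈ slitRegion, HasDerivAt Φ (mlShifted ρ μ z v) v) (φ₁ φ₂ : ℝ) {b : ℝ} (hb : 0 < b)
    (hb1 : b ≠ 1) :
    Φ (((φ₂ - π : ℝ) : ℂ) * Complex.I + (Real.log b : ℂ)) -
      Φ (((φ₁ - π : ℝ) : ℂ) * Complex.I + (Real.log b : ℂ)) =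
    ρ / (2 * π) * ∫ θ in (mlArg z + (φ₁ - π))..(mlArg z + (φ₂ - π)),
      mlIntegrand ρ μ z ((Real.log (‖z‖ * b) : ℂ) + θ * Complex.I) := by
  have hz0 : 0 < ‖z‖ := norm_pos_iff.2 hz
  have hcont := continuous_mlIntegrand_vertical ρ μ (z := z) (b := ‖z‖ * b) (by positivity)
    fun h => hb1 (mul_left_cancel₀ hz0.ne' (by rw [h, mul_one]))
  have hval : ∀ t : ℝ, mlShifted ρ μ z ((Real.log b : ℂ) + t * Complex.I) * Complex.I =
      ρ / (2 * π) * mlIntegrand ρ μ z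
        ((Real.log (‖z‖ * b) : ℂ) + (mlArg z + t : ℝ) * Complex.I) := by
    intro t
    have e : mlLog z + ((Real.log b : ℂ) + t * Complex.I) =
        (Real.log (‖z‖ * b) : ℂ) + (mlArg z + t : ℝ) * Complex.I := by
      rw [Real.log_mul hz0.ne' hb.ne', mlLog]
      push_cast
      ring
    have hI := Complex.I_ne_zero
    have hpi : (π : ℂ) ≠ 0 := by exact_mod_cast Real.pi_ne_zero
    rw [mlShifted, e]
    field_simp
  have h := integral_comp_mul_deriv_of_primitive (F := Φ) (f := mlShifted ρ μ z)
    (a := φ₁ - π) (b := φ₂ - π) (fun t _ => hasDerivAt_vertical (Real.log b) t)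
    (fun t _ => hΦ _ (Or.inl (by simpa using Real.log_ne_zero_of_pos_of_ne_one hb hb1)))
    (by
      simp only [hval]
      refine Continuous.intervalIntegrable (continuous_const.mul ?_) _ _
      exact hcont.comp (continuous_const.add continuous_id))
  rw [add_comm _ (Real.log b : ℂ), add_comm _ (Real.log b : ℂ), ← h]
  simp only [hval]
  rw [intervalIntegral.integral_const_mul, intervalIntegral.integral_comp_add_left
    (fun θ : ℝ => mlIntegrand ρ μ z ((Real.log (‖z‖ * b) : ℂ) + θ * Complex.I))]

/-- The values of `Φ` at the four corners of the sector can be grouped along the rays or along the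
arcs. The first grouping tends to `I₂ - I₁`. In the second, the outer arc tends to the
Mittag-Leffler function and the inner arc to `0`. -/
theorem mlE_eq_sub {ρ : ℝ} (hρ : 0 < ρ) {μ z : ℂ} (hμ : μ.re < 1 + 1 / ρ) (hz : z ≠ 0)
    {Φ : ℂ → ℂ} (hΦ : ∀ v ∈ slitRegion, HasDerivAt Φ (mlShifted ρ μ z v) v) {φ₁ φ₂ : ℝ}
    (h₁ : -(mlArg z + (φ₁ - π)) ∈ Set.Ioo (π / (2 * ρ)) (3 * π / (2 * ρ)))
    (h₂ : mlArg z + (φ₂ - π) ∈ Set.Ioo (π / (2 * ρ)) (3 * π / (2 * ρ))) {I₁ I₂ : ℂ}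
    (hI₁ : Filter.Tendsto (fun b : ℝ => Φ (((φ₁ - π : ℝ) : ℂ) * Complex.I + (Real.log b : ℂ)) -
      Φ (((φ₁ - π : ℝ) : ℂ) * Complex.I + (Real.log b⁻¹ : ℂ))) Filter.atTop (nhds I₁))
    (hI₂ : Filter.Tendsto (fun b : ℝ => Φ (((φ₂ - π : ℝ) : ℂ) * Complex.I + (Real.log b : ℂ)) -
      Φ (((φ₂ - π : ℝ) : ℂ) * Complex.I + (Real.log b⁻¹ : ℂ))) Filter.atTop (nhds I₂)) :
    mlE ρ μ z = I₂ - I₁ := by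
  have hz0 : 0 < ‖z‖ := norm_pos_iff.2 hz
  have hA := ((tendsto_integral_mlIntegrand hρ μ z h₁ h₂).comp
    (Filter.tendsto_id.const_mul_atTop hz0)).const_mul (ρ / (2 * π) : ℂ)
  have hinv : Filter.Tendsto (fun b : ℝ => ‖z‖ * b⁻¹) Filter.atTop
      (nhdsWithin 0 (Set.Ioi 0)) := by
    refine tendsto_nhdsWithin_iff.2 ⟨?_, ?_⟩
    · simpa using tendsto_inv_atTop_zero.const_mul ‖z‖
    · filter_upwards [Filter.eventually_gt_atTop 0] with b hb
      exact mul_pos hz0 (inv_pos.2 hb)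
  have hB := ((tendsto_integral_mlIntegrand_nhdsGT_zero hρ hμ hz (mlArg z + (φ₁ - π))
    (mlArg z + (φ₂ - π))).comp hinv).const_mul (ρ / (2 * π) : ℂ)
  have hC := hA.sub hB
  have e : (ρ / (2 * π) : ℂ) * (2 * π / ρ * mlE ρ μ z) - ρ / (2 * π) * 0 = mlE ρ μ z := by
    have hpi : (π : ℂ) ≠ 0 := by exact_mod_cast Real.pi_ne_zero
    have hρ' : (ρ : ℂ) ≠ 0 := by exact_mod_cast hρ.ne'
    field_simp
    ring
  rw [e] at hC
  refine tendsto_nhds_unique hC ((hI₂.sub hI₁).congr' ?_)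
  filter_upwards [Filter.eventually_gt_atTop 1] with b hb
  have hb0 : 0 < b := by linarith
  have h3 := primitive_sub_eq_integral hz hΦ φ₁ φ₂ hb0 hb.ne'
  have h4 := primitive_sub_eq_integral hz hΦ φ₁ φ₂ (inv_pos.2 hb0) (inv_lt_one_of_one_lt₀ hb).ne
  simp only [Function.comp, id]
  rw [← h3, ← h4]
  ring

theorem log_one_add_mul_exp {ε ψ : ℝ} {x : ℝ} (hx : 0 < 1 + ε * x)
    (hψ : Complex.exp (ψ * Complex.I) = x) :
    Complex.log (1 + ε * Complex.exp (ψ * Complex.I)) = (Real.log (1 + ε * x) : ℂ) := by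
  rw [hψ, Complex.ofReal_log hx.le]
  push_cast
  rfl

theorem exp_neg_pi_mul_I : Complex.exp ((-π : ℝ) * Complex.I) = -1 := by
  rw [Complex.ofReal_neg, neg_mul, Complex.exp_neg, Complex.exp_pi_mul_I]
  norm_num

theorem sin_nonpos_of_mem_uIcc_neg_pi_zero {ψ : ℝ} (hψ : ψ ∈ Set.uIcc (-π) 0) :
    Real.sin ψ ≤ 0 := by
  rw [Set.uIcc_of_le (by linarith [Real.pi_pos])] at hψ
  exact Real.sin_nonpos_of_nonpos_of_neg_pi_le hψ.2 hψ.1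

theorem sin_nonneg_of_mem_uIcc_neg_two_pi_neg_pi {ψ : ℝ}
    (hψ : ψ ∈ Set.uIcc (-(2 * π)) (-π)) : 0 ≤ Real.sin ψ := by
  rw [Set.uIcc_of_le (by linarith [Real.pi_pos])] at hψ
  rw [← Real.sin_add_two_pi]
  exact Real.sin_nonneg_of_nonneg_of_le_pi (by linarith [hψ.1]) (by linarith [hψ.2])

/-- The arc passing below the pole. -/
theorem integral_mlP'_lower_eq {ρ : ℝ} {μ z : ℂ} (hz : z ≠ 0) {Φ : ℂ → ℂ}
    (hΦ : ∀ v ∈ slitRegion, HasDerivAt Φ (mlShifted ρ μ z v) v) {ε : ℝ} (h0 : 0 < ε) (h1 : ε < 1) :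
    ∫ ψ in (-π)..0, mlP' ρ μ ε ψ 0 z =
      Φ (((π - π : ℝ) : ℂ) * Complex.I + (Real.log (1 + ε) : ℂ)) -
        Φ (((π - π : ℝ) : ℂ) * Complex.I + (Real.log (1 - ε) : ℂ)) := by
  rw [integral_mlP'_eq_sub hz hΦ h0 h1 Even.zero fun ψ hψ =>
    Or.inl ⟨rfl, sin_nonpos_of_mem_uIcc_neg_pi_zero hψ⟩,
    log_one_add_mul_exp (x := 1) (by linarith) (by simp),
    log_one_add_mul_exp (x := -1) (by linarith) (by rw [exp_neg_pi_mul_I]; simp)]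
  simp [sub_eq_add_neg]

/-- The arc passing above the pole. -/
theorem integral_mlP'_upper_eq {ρ : ℝ} {μ z : ℂ} (hz : z ≠ 0) {Φ : ℂ → ℂ}
    (hΦ : ∀ v ∈ slitRegion, HasDerivAt Φ (mlShifted ρ μ z v) v) {ε : ℝ} (h0 : 0 < ε) (h1 : ε < 1) :
    -∫ ψ in (-(2 * π))..(-π), mlP' ρ μ ε ψ (-2) z =
      Φ (((-π - π : ℝ) : ℂ) * Complex.I + (Real.log (1 + ε) : ℂ)) -
        Φ (((-π - π : ℝ) : ℂ) * Complex.I + (Real.log (1 - ε) : ℂ)) := by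
  have e : (((-π - π : ℝ) : ℂ) * Complex.I) = ((-2 : ℤ) : ℂ) * π * Complex.I := by
    push_cast
    ring
  -- As `ψ` increases from `-2π` to `-π`, the point `1 + ε e^{iψ}` goes from `1 + ε` to `1 - ε`,
  -- against the direction of the ray; this is the source of the minus sign.
  rw [integral_mlP'_eq_sub hz hΦ h0 h1 (k := -2) ⟨-1, rfl⟩ fun ψ hψ =>
    Or.inr ⟨rfl, sin_nonneg_of_mem_uIcc_neg_two_pi_neg_pi hψ⟩,
    log_one_add_mul_exp (x := -1) (by linarith) (by rw [exp_neg_pi_mul_I]; simp),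
    log_one_add_mul_exp (x := 1) (by linarith) (by
      push_cast
      rw [neg_mul, Complex.exp_neg, Complex.exp_two_pi_mul_I, inv_one]), e, neg_sub]
  rw [mul_one, mul_neg_one, ← sub_eq_add_neg, add_comm (Real.log (1 + ε) : ℂ),
    add_comm (Real.log (1 - ε) : ℂ)]

theorem intervalIntegrable_mlP'_lower (ρ : ℝ) (μ : ℂ) {z : ℂ} (hz : z ≠ 0) {ε : ℝ} (h0 : 0 < ε)
    (h1 : ε < 1) : IntervalIntegrable (fun ψ : ℝ => mlP' ρ μ ε ψ 0 z) volume (-π) 0 :=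
  (continuousOn_mlP' ρ μ hz h0 h1 (fun _ hψ =>
    Or.inl ⟨rfl, sin_nonpos_of_mem_uIcc_neg_pi_zero hψ⟩) Even.zero).intervalIntegrable

theorem intervalIntegrable_mlP'_upper (ρ : ℝ) (μ : ℂ) {z : ℂ} (hz : z ≠ 0) {ε : ℝ} (h0 : 0 < ε)
    (h1 : ε < 1) :
    IntervalIntegrable (fun ψ : ℝ => mlP' ρ μ ε ψ (-2) z) volume (-(2 * π)) (-π) :=
  (continuousOn_mlP' ρ μ hz h0 h1 (fun _ hψ =>
    Or.inr ⟨rfl, sin_nonneg_of_mem_uIcc_neg_two_pi_neg_pi hψ⟩) ⟨-1, rfl⟩).intervalIntegrable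

theorem integrable_mlK'_punctured {ρ : ℝ} (hρ : 0 < ρ) {μ z : ℂ} (hμ : μ.re < 1 + 1 / ρ)
    (hz : z ≠ 0) {φ : ℝ} (hcos : Real.cos (ρ * (mlArg z + (φ - π))) < 0)
    (hφ : Complex.exp (φ * Complex.I) = -1) {ε : ℝ} (h0 : 0 < ε) (h1 : ε < 1) :
    IntervalIntegrable (fun r : ℝ => mlK' ρ μ r φ z) volume 0 (1 - ε) ∧
      IntegrableOn (fun r : ℝ => mlK' ρ μ r φ z) (Set.Ioi (1 + ε)) := by
  constructor
  · rw [intervalIntegrable_iff_integrableOn_Ioc_of_le (by linarith)]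
    refine integrableOn_mlK'_of_exp_eq hρ hμ hz hcos hφ h0 measurableSet_Ioc
      Set.Ioc_subset_Ioi_self fun r hr => ?_
    exact le_trans (by linarith [hr.2]) (le_abs_self _)
  · refine integrableOn_mlK'_of_exp_eq hρ hμ hz hcos hφ h0 measurableSet_Ioi
      (Set.Ioi_subset_Ioi (by linarith)) fun r hr => ?_
    have : 1 + ε < r := hr
    exact le_trans (by linarith) (neg_le_abs _)

theorem ne_zero_of_mlArg_pos {z : ℂ} (h : 0 < mlArg z) : z ≠ 0 := by
  rintro rfl
  simp [mlArg] at h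

theorem cos_mul_neg_of_mem_Ioo {ρ θ : ℝ} (hρ : 0 < ρ)
    (hθ : θ ∈ Set.Ioo (π / (2 * ρ)) (3 * π / (2 * ρ))) : Real.cos (ρ * θ) < 0 :=
  cos_mul_neg_of_mem_uIcc hρ hθ hθ Set.left_mem_uIcc

theorem cos_mul_neg_of_neg_mem_Ioo {ρ θ : ℝ} (hρ : 0 < ρ)
    (hθ : -θ ∈ Set.Ioo (π / (2 * ρ)) (3 * π / (2 * ρ))) : Real.cos (ρ * θ) < 0 := by
  rw [← Real.cos_neg, ← mul_neg]
  exact cos_mul_neg_of_mem_Ioo hρ hθ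

theorem exists_primitive_mlShifted (ρ : ℝ) (μ : ℂ) {z : ℂ} (hz : z ≠ 0) :
    ∃ Φ : ℂ → ℂ, ∀ v ∈ slitRegion, HasDerivAt Φ (mlShifted ρ μ z v) v :=
  starConvex_slitRegion.exists_primitive isOpen_slitRegion (differentiableOn_mlShifted ρ μ hz)

/-- The end points of a contour with opening angles `δ₁`, `δ₂` lie in the sectors of decay. -/
theorem contour_angles_mem {ρ δ₁ δ₂ a : ℝ} (h1 : δ₁ ≤ π / ρ) (h2 : δ₂ ≤ π / ρ)
    (ha1 : π / (2 * ρ) - δ₂ + π < a) (ha2 : a < -(π / (2 * ρ)) + δ₁ + π) :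
    -(a + (-δ₁ - π)) ∈ Set.Ioo (π / (2 * ρ)) (3 * π / (2 * ρ)) ∧
      a + (δ₂ - π) ∈ Set.Ioo (π / (2 * ρ)) (3 * π / (2 * ρ)) := by
  have e1 : π / ρ = 2 * (π / (2 * ρ)) := by
    rw [mul_comm 2 ρ, ← div_div]; ring
  have e2 : 3 * π / (2 * ρ) = 3 * (π / (2 * ρ)) := by ring
  rw [e1] at h1 h2
  rw [e2]
  refine ⟨⟨?_, ?_⟩, ⟨?_, ?_⟩⟩ <;> linarith

/-! ### The four representations. -/

theorem theorem3 (ρ : ℝ) (μ : ℂ) (hρ : 1 / 2 < ρ) (hμ : μ.re < 1 + 1 / ρ) :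
    -- the series that defines the function converges
    (∀ z : ℂ, Summable (mlTerm ρ μ z)) ∧
    -- item 1
    (∀ δ₁ δ₂ : ℝ,
      (1 < ρ → π / (2 * ρ) < δ₁ ∧ δ₁ ≤ π / ρ ∧ π / (2 * ρ) < δ₂ ∧ δ₂ ≤ π / ρ) →
      (ρ ≤ 1 → π / (2 * ρ) < δ₁ ∧ δ₁ < π ∧ π / (2 * ρ) < δ₂ ∧ δ₂ < π) →
      ∀ z : ℂ, π / (2 * ρ) - δ₂ + π < mlArg z → mlArg z < -(π / (2 * ρ)) + δ₁ + π →
        IntegrableOn (fun r : ℝ => mlK ρ μ r (-δ₁) δ₂ z) (Set.Ioi 0) ∧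
        mlE ρ μ z = ∫ r in Set.Ioi (0 : ℝ), mlK ρ μ r (-δ₁) δ₂ z) ∧
    -- item 2
    (ρ ≤ 1 → ∀ δ₂ : ℝ, π / (2 * ρ) < δ₂ → δ₂ < π →
      ∀ z : ℂ, π / (2 * ρ) - δ₂ + π < mlArg z → mlArg z < -(π / (2 * ρ)) + 2 * π →
      ∀ ε₁ : ℝ, 0 < ε₁ → ε₁ < 1 →
        IntegrableOn (fun r : ℝ => mlK' ρ μ r δ₂ z) (Set.Ioi 0) ∧
        IntervalIntegrable (fun r : ℝ => mlK' ρ μ r (-π) z) volume 0 (1 - ε₁) ∧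
        IntegrableOn (fun r : ℝ => mlK' ρ μ r (-π) z) (Set.Ioi (1 + ε₁)) ∧
        IntervalIntegrable (fun ψ : ℝ => mlP' ρ μ ε₁ ψ (-2) z) volume (-(2 * π)) (-π) ∧
        mlE ρ μ z =
          (∫ r in Set.Ioi (0 : ℝ), mlK' ρ μ r δ₂ z)
            - (∫ r in (0 : ℝ)..(1 - ε₁), mlK' ρ μ r (-π) z)
            - (∫ r in Set.Ioi (1 + ε₁), mlK' ρ μ r (-π) z)
            + ∫ ψ in (-(2 * π))..(-π), mlP' ρ μ ε₁ ψ (-2) z) ∧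
    -- item 3
    (ρ ≤ 1 → ∀ δ₁ : ℝ, π / (2 * ρ) < δ₁ → δ₁ < π →
      ∀ z : ℂ, π / (2 * ρ) < mlArg z → mlArg z < -(π / (2 * ρ)) + δ₁ + π →
      ∀ ε₁ : ℝ, 0 < ε₁ → ε₁ < 1 →
        IntervalIntegrable (fun r : ℝ => mlK' ρ μ r π z) volume 0 (1 - ε₁) ∧
        IntegrableOn (fun r : ℝ => mlK' ρ μ r π z) (Set.Ioi (1 + ε₁)) ∧
        IntervalIntegrable (fun ψ : ℝ => mlP' ρ μ ε₁ ψ 0 z) volume (-π) 0 ∧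
        IntegrableOn (fun r : ℝ => mlK' ρ μ r (-δ₁) z) (Set.Ioi 0) ∧
        mlE ρ μ z =
          (∫ r in (0 : ℝ)..(1 - ε₁), mlK' ρ μ r π z)
            + (∫ r in Set.Ioi (1 + ε₁), mlK' ρ μ r π z)
            + (∫ ψ in (-π)..0, mlP' ρ μ ε₁ ψ 0 z)
            - ∫ r in Set.Ioi (0 : ℝ), mlK' ρ μ r (-δ₁) z) ∧
    -- item 4
    (ρ ≤ 1 →
      ∀ z : ℂ, π / (2 * ρ) < mlArg z → mlArg z < -(π / (2 * ρ)) + 2 * π →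
      ∀ ε₁ : ℝ, 0 < ε₁ → ε₁ < 1 →
        IntervalIntegrable (fun r : ℝ => mlKSym ρ μ r π z) volume 0 (1 - ε₁) ∧
        IntegrableOn (fun r : ℝ => mlKSym ρ μ r π z) (Set.Ioi (1 + ε₁)) ∧
        IntervalIntegrable (fun ψ : ℝ => mlP' ρ μ ε₁ ψ 0 z) volume (-π) 0 ∧
        IntervalIntegrable (fun ψ : ℝ => mlP' ρ μ ε₁ ψ (-2) z) volume (-(2 * π)) (-π) ∧
        mlE ρ μ z =
          (∫ r in (0 : ℝ)..(1 - ε₁), mlKSym ρ μ r π z)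
            + (∫ r in Set.Ioi (1 + ε₁), mlKSym ρ μ r π z)
            + (∫ ψ in (-π)..0, mlP' ρ μ ε₁ ψ 0 z)
            + ∫ ψ in (-(2 * π))..(-π), mlP' ρ μ ε₁ ψ (-2) z) := by
  have hρ0 : 0 < ρ := by linarith
  have hπ := Real.pi_pos
  have hθ0 : 0 < π / (2 * ρ) := by positivity
  have hθπ : π / (2 * ρ) < π := by
    rw [div_lt_iff₀ (by positivity)]
    nlinarith
  have hπle : ρ ≤ 1 → π ≤ π / ρ := fun h => by
    rw [le_div_iff₀ hρ0]
    nlinarith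
  have hexpπ : Complex.exp ((π : ℝ) * Complex.I) = -1 := Complex.exp_pi_mul_I
  have habs : ∀ δ : ℝ, 0 < δ → δ < π → |δ| < π ∧ |-δ| < π := fun δ h0 h1 => by
    rw [abs_neg, abs_of_pos h0]
    exact ⟨h1, h1⟩
  refine ⟨summable_mlTerm hρ0 μ, ?_, ?_, ?_, ?_⟩
  · intro δ₁ δ₂ hgt hle z hz1 hz2
    -- The two regimes merge: `π/ρ < π` when `ρ > 1` and `π ≤ π/ρ` when `ρ ≤ 1`, so each `δ` is
    -- below `π` and at most `π/ρ` in either case.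
    have hδ : π / (2 * ρ) < δ₁ ∧ δ₁ ≤ π / ρ ∧ δ₁ < π ∧ π / (2 * ρ) < δ₂ ∧ δ₂ ≤ π / ρ ∧ δ₂ < π := by
      rcases lt_or_ge 1 ρ with h | h
      · obtain ⟨a, b, c, d⟩ := hgt h
        have := div_lt_self hπ h
        exact ⟨a, b, b.trans_lt this, c, d, d.trans_lt this⟩
      · obtain ⟨a, b, c, d⟩ := hle h
        have := hπle h
        exact ⟨a, by linarith, b, c, by linarith, d⟩
    obtain ⟨a1, b1, c1, a2, b2, c2⟩ := hδ
    have hz := ne_zero_of_mlArg_pos (z := z) (by linarith)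
    obtain ⟨Φ, hΦ⟩ := exists_primitive_mlShifted ρ μ hz
    obtain ⟨m1, m2⟩ := contour_angles_mem b1 b2 hz1 hz2
    have p1 := (habs δ₁ (by linarith) c1).2
    have p2 := (habs δ₂ (by linarith) c2).1
    have i1 := integrableOn_mlK'_of_abs_lt_pi hρ0 hμ hz (cos_mul_neg_of_neg_mem_Ioo hρ0 m1)
      (by linarith) p1
    have i2 := integrableOn_mlK'_of_abs_lt_pi hρ0 hμ hz (cos_mul_neg_of_mem_Ioo hρ0 m2)
      (by linarith) p2
    have hK : Set.EqOn (fun r => mlK ρ μ r (-δ₁) δ₂ z)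
        (fun r => mlK' ρ μ r δ₂ z - mlK' ρ μ r (-δ₁) z) (Set.Ioi 0) :=
      fun r hr => mlK_eq ρ μ z hr p1 p2
    refine ⟨(i2.sub i1).congr_fun hK.symm measurableSet_Ioi, ?_⟩
    rw [setIntegral_congr_fun measurableSet_Ioi hK, integral_sub i2 i1]
    exact mlE_eq_sub hρ0 hμ hz hΦ m1 m2 (tendsto_primitive_sub_straight hz hΦ p1 i1)
      (tendsto_primitive_sub_straight hz hΦ p2 i2)
  · intro hρ1 δ₂ a2 c2 z hz1 hz2 ε h0 h1
    have hz := ne_zero_of_mlArg_pos (z := z) (by linarith)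
    obtain ⟨Φ, hΦ⟩ := exists_primitive_mlShifted ρ μ hz
    -- This is the contour with `δ₁ = π`; its first ray meets the pole `-2πi` and is dented from
    -- above.
    obtain ⟨m1, m2⟩ := contour_angles_mem (hπle hρ1) (c2.le.trans (hπle hρ1)) hz1
      (show mlArg z < -(π / (2 * ρ)) + π + π by linarith)
    have p2 := (habs δ₂ (by linarith) c2).1
    have i2 := integrableOn_mlK'_of_abs_lt_pi hρ0 hμ hz (cos_mul_neg_of_mem_Ioo hρ0 m2)
      (by linarith) p2
    obtain ⟨j1, j2⟩ := integrable_mlK'_punctured hρ0 hμ hz (cos_mul_neg_of_neg_mem_Ioo hρ0 m1)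
      exp_neg_pi_mul_I h0 h1
    refine ⟨i2, j1, j2, intervalIntegrable_mlP'_upper ρ μ hz h0 h1, ?_⟩
    rw [mlE_eq_sub hρ0 hμ hz hΦ m1 m2 (tendsto_primitive_sub_dented hz hΦ h0 h1 j1 j2
      (integral_mlP'_upper_eq hz hΦ h0 h1)) (tendsto_primitive_sub_straight hz hΦ p2 i2)]
    ring
  · intro hρ1 δ₁ a1 c1 z hz1 hz2 ε h0 h1
    have hz := ne_zero_of_mlArg_pos (z := z) (by linarith)
    obtain ⟨Φ, hΦ⟩ := exists_primitive_mlShifted ρ μ hz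
    -- Now `δ₂ = π`, and the second ray meets the pole `0` and is dented from below.
    obtain ⟨m1, m2⟩ := contour_angles_mem (c1.le.trans (hπle hρ1)) (hπle hρ1)
      (show π / (2 * ρ) - π + π < mlArg z by linarith) hz2
    have p1 := (habs δ₁ (by linarith) c1).2
    have i1 := integrableOn_mlK'_of_abs_lt_pi hρ0 hμ hz (cos_mul_neg_of_neg_mem_Ioo hρ0 m1)
      (by linarith) p1
    obtain ⟨j1, j2⟩ := integrable_mlK'_punctured hρ0 hμ hz (cos_mul_neg_of_mem_Ioo hρ0 m2)
      hexpπ h0 h1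
    refine ⟨j1, j2, intervalIntegrable_mlP'_lower ρ μ hz h0 h1, i1, ?_⟩
    exact mlE_eq_sub hρ0 hμ hz hΦ m1 m2 (tendsto_primitive_sub_straight hz hΦ p1 i1)
      (tendsto_primitive_sub_dented hz hΦ h0 h1 j1 j2 (integral_mlP'_lower_eq hz hΦ h0 h1))
  · intro hρ1 z hz1 hz2 ε h0 h1
    have hz := ne_zero_of_mlArg_pos (z := z) (by linarith)
    obtain ⟨Φ, hΦ⟩ := exists_primitive_mlShifted ρ μ hz
    obtain ⟨m1, m2⟩ := contour_angles_mem (hπle hρ1) (hπle hρ1)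
      (show π / (2 * ρ) - π + π < mlArg z by linarith)
      (show mlArg z < -(π / (2 * ρ)) + π + π by linarith)
    obtain ⟨j1, j2⟩ := integrable_mlK'_punctured hρ0 hμ hz (cos_mul_neg_of_neg_mem_Ioo hρ0 m1)
      exp_neg_pi_mul_I h0 h1
    obtain ⟨k1, k2⟩ := integrable_mlK'_punctured hρ0 hμ hz (cos_mul_neg_of_mem_Ioo hρ0 m2)
      hexpπ h0 h1
    simp only [mlKSym_eq]
    refine ⟨k1.sub j1, k2.sub j2, intervalIntegrable_mlP'_lower ρ μ hz h0 h1,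
      intervalIntegrable_mlP'_upper ρ μ hz h0 h1, ?_⟩
    rw [intervalIntegral.integral_sub k1 j1, integral_sub k2 j2,
      mlE_eq_sub hρ0 hμ hz hΦ m1 m2 (tendsto_primitive_sub_dented hz hΦ h0 h1 j1 j2
        (integral_mlP'_upper_eq hz hΦ h0 h1)) (tendsto_primitive_sub_dented hz hΦ h0 h1 k1 k2
        (integral_mlP'_lower_eq hz hΦ h0 h1))]
    ring
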